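/- Let $\mathbb E$ be a finite-dimensional complex vector space with a Hermitian metric, normalized so that its Kähler form is $\omega_{\mathbb E}=i\sum_j dz_j\wedge d\bar z_j$ in orthonormal complex coordinates. Let $\Gamma\subset\mathbb E$ be a discrete additive subgroup, $\Gamma_{\mathbb R}$ its real linear span, $\mathbb T=\mathbb E/\Gamma$, and $\pi:\mathbb E\to\mathbb T$ the projection. Write $\mathbb D^*=\{0<|x|<1\}$ and $\overline{\mathbb D}^*=\{0<|x|\le 1\}$. Let $f:\overline{\mathbb D}^*\to\mathbb E$ be a smooth map which is holomorphic on $\mathbb D^*$, has polynomial growth at $0$ (that is, $\|f(x)\|=O(|x|^{-N})$ as $x\to0$ for some integer $N$) and is not bounded. Then there are an integer $k\ge1$, integers $d_1>\dots>d_k>d_{k+1}=0$ and vectors $v_1,\dots,v_{k+1}\in\mathbb E$, with $v_1,\dots,v_k$ linearly independent over $\mathbb C$, such that, as $x\to0$, $$f(x)=(1+O(x))\,x^{-d_1}v_1+\dots+(1+O(x))\,x^{-d_k}v_k+v_{k+1}+O(x).$$ For every such choice put $d=d_1$, let $\mathbb F_k$ be the complex span of $v_1,\dots,v_k$, and let $V=\mathbb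 F_k+v_{k+1}$. Then $\mathbb F_k\subset\Gamma_{\mathbb R}$ if and only if $\overline{\pi(V)}$ is a translate of a compact real subtorus of $\mathbb T$ (i.e. is of the form $\pi(c+W)$, where $c\in\mathbb E$ and $W$ is a real vector subspace of $\mathbb E$ spanned over $\mathbb R$ by $\Gamma\cap W$). Suppose that $\mathbb F_k\subset\Gamma_{\mathbb R}$. Then: 1. There is a unique Haar probability measure $\mu_V$ on $\overline{\pi(V)}$, i.e. a unique Borel probability measure on $\mathbb T$ carried by $\overline{\pi(V)}$ and invariant under all translations of $\mathbb T$ that preserve $\overline{\pi(V)}$. For every non-empty connected open set $U$ whose closure is contained in $\mathbb D^*$, put $U_a=aU$ and $$\lambda_0=d^2\|v_1\|^2\int_U|x|^{-2d-2}\,(i\,dx\wedge d\bar x),\qquad \mu_a=\lambda_0^{-1}|a|^{2d}\,\pi_*\big(f_*[U_a]\wedge\omega_{\mathbb E}\big),$$ where $f_*[U_a]\wedge\omega_{\mathbb E}$ is the positive measure $\varphi\mapsto\int_{U_a}(\varphi\circ f)\,f^*\omega_{\mathbb E}$. Then $\mu_a$ converges weakly to $\mu_V$ as $a\to0$ in $\mathbb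 C\setminus\{0\}$, i.e. $\int g\,d\mu_a\to\int g\,d\mu_V$ for every bounded continuous $g:\mathbb T\to\mathbb R$. 2. The set $\Lambda_f$ of cluster values of $\pi(f(x))$ as $x\to0$ equals $\overline{\pi(V)}$. 3. $\overline{\pi(f(\mathbb D^*))}=\pi(f(\overline{\mathbb D}^*))\cup\overline{\pi(V)}$. -/

import Mathlib

open MeasureTheory Filter Topology Asymptotics
open scoped ContDiff BoundedContinuousFunction

noncomputable section

namespace OneDimFlow

/-- The punctured open unit disc `𝔻*`. -/
def puncturedDisc : Set ℂ := {x | x ≠ 0 ∧ ‖x‖ < 1}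

/-- The punctured closed unit disc. -/
def closedPuncturedDisc : Set ℂ := {x | x ≠ 0 ∧ ‖x‖ ≤ 1}

variable {E : Type*} [NormedAddCommGroup E] [InnerProductSpace ℂ E]

/-- `f` has polynomial growth at `0`: `‖f x‖ = O(|x| ^ (-N))` as `x → 0`, for some integer `N`. -/
def HasPolynomialGrowth (f : ℂ → E) : Prop :=
  ∃ N : ℤ, f =O[𝓝[≠] (0 : ℂ)] fun x => x ^ (-N)

/-- The data `k`, `d₁ > ⋯ > d_k > d_{k+1} = 0`, `v₁, …, v_{k+1}` (only the indices
`1, …, k + 1` of the sequences `d` and `v` are used), with `v₁, …, v_k` linearly independent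
over `ℂ`, form an expansion
`f(x) = (1 + O(x)) x^{-d₁} v₁ + ⋯ + (1 + O(x)) x^{-d_k} v_k + v_{k+1} + O(x)` as `x → 0`. -/
structure IsExpansion (f : ℂ → E) (k : ℕ) (d : ℕ → ℕ) (v : ℕ → E) : Prop where
  one_le : 1 ≤ k
  strictAnti : StrictAntiOn d (Set.Icc 1 (k + 1))
  last : d (k + 1) = 0
  linearIndep : LinearIndepOn ℂ v (Set.Icc 1 k)
  expansion : ∃ (h : ℕ → ℂ → ℂ) (r : ℂ → E),
    (∀ j ∈ Finset.Icc 1 k, h j =O[𝓝[≠] (0 : ℂ)] fun x => x) ∧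
    r =O[𝓝[≠] (0 : ℂ)] (fun x => x) ∧
    ∀ᶠ x in 𝓝[≠] (0 : ℂ),
      f x = ∑ j ∈ Finset.Icc 1 k, ((1 + h j x) * (x ^ d j)⁻¹) • v j + v (k + 1) + r x

/-- The complex span `𝔽_l` of `v₁, …, v_l`. -/
def flag (v : ℕ → E) (l : ℕ) : Submodule ℂ E := Submodule.span ℂ (v '' Set.Icc 1 l)

/-- The affine space `V = 𝔽_k + v_{k+1}`. -/
def affineV (v : ℕ → E) (k : ℕ) : AffineSubspace ℂ E :=
  AffineSubspace.mk' (v (k + 1)) (flag v k)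

/-- The Kähler form `ω_𝔼` of the Hermitian metric of `E`. In orthonormal complex coordinates it
is `i ∑ dz_j ∧ dz̄_j`. -/
def kahlerForm (u w : E) : ℝ := 2 * (inner ℂ u w).im

/-- The pullback `f^* ω_𝔼 = pullbackDensity f x · dx₁ ∧ dx₂`, where `x = x₁ + i x₂`. -/
def pullbackDensity (f : ℂ → E) (x : ℂ) : ℝ :=
  kahlerForm (fderiv ℝ f x 1) (fderiv ℝ f x Complex.I)

/-- The positive measure `f_*[W] ∧ ω_𝔼` on `E`, that is `φ ↦ ∫_W (φ ∘ f) f^* ω_𝔼`. -/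
def areaMeasure [MeasurableSpace E] (f : ℂ → E) (W : Set ℂ) : Measure E :=
  ((volume.restrict W).withDensity fun x => ENNReal.ofReal (pullbackDensity f x)).map f

/-- `λ₀ = d² ‖v₁‖² ∫_U |x|^{-2d-2} (i dx ∧ dx̄)`; recall that `i dx ∧ dx̄` is twice the
Lebesgue measure. -/
def lambdaZero (U : Set ℂ) (d : ℕ) (v₁ : E) : ℝ :=
  (d : ℝ) ^ 2 * ‖v₁‖ ^ 2 * ∫ x in U, (‖x‖ ^ (2 * d + 2))⁻¹ * 2

/-- The canonical projection `π : 𝔼 → 𝕋 = 𝔼 / Γ`. -/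
def proj (Γ : AddSubgroup E) : E → E ⧸ Γ := fun z => (z : E ⧸ Γ)

/-- The normalized measure `μ_a = λ₀⁻¹ |a|^{2d} π_*(f_*[aU] ∧ ω_𝔼)` on `𝕋`. -/
def mu [MeasurableSpace E] (Γ : AddSubgroup E) (f : ℂ → E) (d : ℕ) (v₁ : E) (U : Set ℂ) (a : ℂ) :
    Measure (E ⧸ Γ) :=
  ENNReal.ofReal ((lambdaZero U d v₁)⁻¹ * ‖a‖ ^ (2 * d)) •
    (areaMeasure f ((fun x => a * x) '' U)).map (proj Γ)

/-- The real span `Γ_ℝ` of `Γ`. -/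
def realSpan (Γ : AddSubgroup E) : Submodule ℝ E := Submodule.span ℝ (Γ : Set E)

/-- `S` is a translate of a compact real subtorus of `𝕋`: `S = π(c + W)`, where `W` is a real
vector subspace of `E` in which `Γ ∩ W` is a lattice of full rank. -/
def IsTranslatedSubtorus (Γ : AddSubgroup E) (S : Set (E ⧸ Γ)) : Prop :=
  ∃ (c : E) (W : Submodule ℝ E),
    W = Submodule.span ℝ ((Γ : Set E) ∩ W) ∧ S = proj Γ '' (AffineSubspace.mk' c W : Set E)

/-- The Haar probability measure on a translate `S` of a compact subgroup of `T`: the Borel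
probability measure on `T` carried by `S` and invariant under all the translations of `T`
that preserve `S` (if `S = c + H`, these are the translations by the elements of `H`). -/
structure IsHaarProbabilityOn {T : Type*} [AddCommGroup T] [MeasurableSpace T]
    (ν : Measure T) (S : Set T) : Prop where
  prob : IsProbabilityMeasure ν
  carried : ν Sᶜ = 0
  invariant : ∀ t : T, (fun s => t + s) '' S = S → ν.map (fun s => t + s) = ν

/-- The set `Λ_f` of cluster values of `π (f x)` as `x → 0`. -/
def clusterSet (Γ : AddSubgroup E) (f : ℂ → E) : Set (E ⧸ Γ) :=
  {t | MapClusterPt t (𝓝[≠] (0 : ℂ)) fun x => proj Γ (f x)}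

end OneDimFlow

end

/-!
Near `0` the map `f` is a finite Laurent polynomial with values in `E` plus `O(x)`; grouping the
coefficients by linear dependence on those of higher order gives the expansion, and `f(x)` is
asymptotic to a curve in `V`. Let `W` be the smallest subspace containing `𝔽_k` that is spanned by
elements of `Γ`. A non-trivial character of the torus `W / (Γ ∩ W)` does not vanish on `𝔽_k`, so
along `f` it has the form `exp (2πi Re Q)` with `Q` holomorphic on `𝔻*` and `x Q'(x) → ∞`. One
integration by parts along `∂` then shows that its averages over `aU` tend to `0`. By Weyl's
criterion the rescaled curve equidistributes in `π(v_{k+1} + W)`; this remains true for the area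
measures, whose rescaled density converges uniformly to that of the leading term `x^{-d₁} v₁`. As
the limit has full support, every point of `π(v_{k+1} + W)` is a cluster value of `π ∘ f`, hence
lies in the closure of `π(V)`.
-/

namespace OneDimFlow

open scoped FourierTransform Manifold

section NonstationaryPhase

/-- The Wirtinger derivative `∂u/∂z`. -/
noncomputable def wirtingerDeriv (u : ℂ → ℂ) (z : ℂ) : ℂ :=
  (fderiv ℝ u z 1 - Complex.I * fderiv ℝ u z Complex.I) / 2

theorem wirtingerDeriv_mul {u w : ℂ → ℂ} {z : ℂ} (hu : DifferentiableAt ℝ u z)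
    (hw : DifferentiableAt ℝ w z) :
    wirtingerDeriv (u * w) z = wirtingerDeriv u z * w z + u z * wirtingerDeriv w z := by
  simp only [wirtingerDeriv, fderiv_mul hu hw, add_apply, smul_apply, smul_eq_mul]
  ring

theorem wirtingerDeriv_eq_deriv {u : ℂ → ℂ} {z : ℂ} (hu : DifferentiableAt ℂ u z) :
    wirtingerDeriv u z = deriv u z := by
  rw [wirtingerDeriv, hu.fderiv_restrictScalars ℝ]
  simp only [ContinuousLinearMap.coe_restrictScalars', ← toSpanSingleton_deriv,
    ContinuousLinearMap.toSpanSingleton_apply, smul_eq_mul]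
  linear_combination (-deriv u z / 2) * Complex.I_sq

theorem hasFDerivAt_fourierChar_re {H : ℂ → ℂ} {z : ℂ} (hH : DifferentiableAt ℂ H z) :
    HasFDerivAt (fun z => (𝐞 (H z).re : ℂ))
      (.toSpanSingleton ℝ (2 * Real.pi * Complex.I * 𝐞 (H z).re) ∘L
        Complex.reCLM ∘L fderiv ℝ H z) z := by
  have hre : HasFDerivAt (fun z => (H z).re) (Complex.reCLM ∘L fderiv ℝ H z) z :=
    Complex.reCLM.hasFDerivAt.comp z (hH.restrictScalars ℝ).hasFDerivAt
  exact (Real.hasDerivAt_fourierChar (H z).re).hasFDerivAt.comp z hre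

theorem wirtingerDeriv_fourierChar_re {H : ℂ → ℂ} {z : ℂ} (hH : DifferentiableAt ℂ H z) :
    wirtingerDeriv (fun z => (𝐞 (H z).re : ℂ)) z =
      Real.pi * Complex.I * deriv H z * 𝐞 (H z).re := by
  have hre (w : ℂ) : (w.re : ℂ) - Complex.I * ((w * Complex.I).re : ℂ) = w := by
    apply Complex.ext <;> simp
  rw [wirtingerDeriv, (hasFDerivAt_fourierChar_re hH).fderiv, hH.fderiv_restrictScalars ℝ]
  simp only [ContinuousLinearMap.comp_apply,
    ContinuousLinearMap.coe_restrictScalars', ← toSpanSingleton_deriv,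
    ContinuousLinearMap.toSpanSingleton_apply, smul_eq_mul, one_mul, Complex.reCLM_apply,
    Complex.real_smul, mul_comm Complex.I (deriv H z)]
  linear_combination (Real.pi * Complex.I * 𝐞 (H z).re) * hre (deriv H z)

theorem continuous_wirtingerDeriv {u : ℂ → ℂ} (hu : ContDiff ℝ 1 u) :
    Continuous (wirtingerDeriv u) := by
  have := hu.continuous_fderiv one_ne_zero
  unfold wirtingerDeriv
  fun_prop

theorem wirtingerDeriv_eq_zero_of_notMem_tsupport {u : ℂ → ℂ} {z : ℂ} (hz : z ∉ tsupport u) :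
    wirtingerDeriv u z = 0 := by
  have : fderiv ℝ u z = 0 :=
    image_eq_zero_of_notMem_tsupport fun h => hz (tsupport_fderiv_subset ℝ h)
  simp [wirtingerDeriv, this]

theorem integral_wirtingerDeriv_eq_zero {u : ℂ → ℂ} (hu : ContDiff ℝ 1 u)
    (hc : HasCompactSupport u) : ∫ z, wirtingerDeriv u z = 0 := by
  have hint (v : ℂ) : Integrable fun z => fderiv ℝ u z v :=
    ((hu.continuous_fderiv one_ne_zero).clm_apply continuous_const).integrable_of_hasCompactSupport
      (hc.fderiv_apply ℝ v)
  have hzero (v : ℂ) : ∫ z, fderiv ℝ u z v = 0 := by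
    simpa using integral_mul_fderiv_eq_neg_fderiv_mul_of_integrable (μ := volume) (v := v)
      (f := fun _ => (1 : ℂ)) (g := u) (by simp) (by simpa using hint v)
      (by simpa using hu.continuous.integrable_of_hasCompactSupport hc)
      (fun _ _ => differentiableAt_const _) (fun z _ => hu.differentiable one_ne_zero z)
  simp only [wirtingerDeriv]
  rw [integral_div, integral_sub (hint 1) ((hint Complex.I).const_mul _), integral_const_mul,
    hzero, hzero]
  simp

variable {Ω : Set ℂ}

theorem contDiff_of_contDiffAt_tsupport {𝕜 V F : Type*} [NontriviallyNormedField 𝕜]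
    [NormedAddCommGroup V] [NormedSpace 𝕜 V] [NormedAddCommGroup F] [NormedSpace 𝕜 F] {u : V → F}
    {n : WithTop ℕ∞} (h : ∀ z ∈ tsupport u, ContDiffAt 𝕜 n u z) : ContDiff 𝕜 n u :=
  contMDiff_iff_contDiff.1 <| contMDiff_of_tsupport fun z hz => (h z hz).contMDiffAt

theorem contDiffAt_fourierChar_re {H : ℂ → ℂ} {z : ℂ} (hH : ContDiffAt ℝ 1 H z) :
    ContDiffAt ℝ 1 (fun z => (𝐞 (H z).re : ℂ)) z := by
  simp only [Real.fourierChar_apply]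
  have h : ContDiffAt ℝ 1 (fun z => (H z).re) z := Complex.reCLM.contDiff.contDiffAt.comp z hH
  exact ((Complex.ofRealCLM.contDiff.contDiffAt.comp z (contDiffAt_const.mul h)).mul
    contDiffAt_const).cexp

theorem wirtingerDeriv_fourierChar_re_mul_mul {H φ T : ℂ → ℂ} {z : ℂ}
    (hH : DifferentiableAt ℂ H z) (hφ : DifferentiableAt ℝ φ z) (hT : DifferentiableAt ℂ T z)
    (hHT : deriv H z * T z = 1) :
    wirtingerDeriv ((fun z => (𝐞 (H z).re : ℂ)) * (φ * T)) z =
      Real.pi * Complex.I * (𝐞 (H z).re * φ z) +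
        𝐞 (H z).re * (wirtingerDeriv φ z * T z + φ z * deriv T z) := by
  rw [wirtingerDeriv_mul (hasFDerivAt_fourierChar_re hH).differentiableAt
      (hφ.mul (hT.restrictScalars ℝ)), wirtingerDeriv_fourierChar_re hH,
    wirtingerDeriv_mul hφ (hT.restrictScalars ℝ), wirtingerDeriv_eq_deriv hT]
  simp only [Pi.mul_apply]
  linear_combination (Real.pi * Complex.I * 𝐞 (H z).re * φ z) * hHT

/-- One integration by parts against `∂`, which does not see the antiholomorphic part of the
phase. -/
theorem integral_fourierChar_re_mul_eq {H φ : ℂ → ℂ} (hΩ : IsOpen Ω) (hH : DifferentiableOn ℂ H Ω)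
    (hH' : ∀ z ∈ Ω, deriv H z ≠ 0) (hφ : ContDiff ℝ 1 φ) (hc : HasCompactSupport φ)
    (hsupp : tsupport φ ⊆ Ω) :
    Real.pi * Complex.I * ∫ z, 𝐞 (H z).re * φ z =
      -∫ z, 𝐞 (H z).re *
        (wirtingerDeriv φ z * (deriv H z)⁻¹ + φ z * deriv (fun w => (deriv H w)⁻¹) z) := by
  set T : ℂ → ℂ := fun w => (deriv H w)⁻¹
  set e : ℂ → ℂ := fun z => 𝐞 (H z).re
  set u : ℂ → ℂ := e * (φ * T)
  have hT : DifferentiableOn ℂ T Ω := (hH.deriv hΩ).inv hH'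
  have hsmooth {w : ℂ → ℂ} (hw : DifferentiableOn ℂ w Ω) {z : ℂ} (hz : z ∈ Ω) :
      ContDiffAt ℝ 1 w z :=
    ((hw.analyticAt (hΩ.mem_nhds hz)).contDiffAt.restrict_scalars ℝ)
  have hu0 {z : ℂ} (hz : φ z = 0) : u z = 0 := by simp [u, hz]
  have husupp : tsupport u ⊆ tsupport φ := closure_mono fun z hz h => hz (hu0 h)
  have hu : ContDiff ℝ 1 u := contDiff_of_contDiffAt_tsupport fun z hz =>
    (contDiffAt_fourierChar_re (hsmooth hH (hsupp (husupp hz)))).mul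
      (hφ.contDiffAt.mul (hsmooth hT (hsupp (husupp hz))))
  have hderiv (z : ℂ) : wirtingerDeriv u z = Real.pi * Complex.I * (e z * φ z) +
      e z * (wirtingerDeriv φ z * T z + φ z * deriv T z) := by
    by_cases hz : z ∈ tsupport φ
    · have hzΩ := hΩ.mem_nhds (hsupp hz)
      exact wirtingerDeriv_fourierChar_re_mul_mul (hH.differentiableAt hzΩ)
        (hφ.differentiable one_ne_zero z) (hT.differentiableAt hzΩ)
        (mul_inv_cancel₀ (hH' z (hsupp hz)))
    · rw [wirtingerDeriv_eq_zero_of_notMem_tsupport fun h => hz (husupp h),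
        wirtingerDeriv_eq_zero_of_notMem_tsupport hz, image_eq_zero_of_notMem_tsupport hz]
      simp
  have hint : Integrable fun z => e z * φ z := by
    refine (integrableOn_iff_integrable_of_support_subset (s := tsupport φ) fun z hz => ?_).1 ?_
    · exact subset_tsupport φ (right_ne_zero_of_mul hz)
    · exact ContinuousOn.integrableOn_compact hc fun z hz =>
        ((contDiffAt_fourierChar_re (hsmooth hH (hsupp hz))).continuousAt.mul
          hφ.continuous.continuousAt).continuousWithinAt
  have huint : Integrable (wirtingerDeriv u) :=
    (continuous_wirtingerDeriv hu).integrable_of_hasCompactSupport <| hc.mono' fun z hz =>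
      husupp (by_contra fun h => hz (wirtingerDeriv_eq_zero_of_notMem_tsupport h))
  calc Real.pi * Complex.I * ∫ z, e z * φ z
      = -∫ z, (wirtingerDeriv u z - Real.pi * Complex.I * (e z * φ z)) := by
        rw [integral_sub huint (hint.const_mul _), integral_const_mul,
          integral_wirtingerDeriv_eq_zero hu (hc.mono' (subset_closure.trans husupp))]
        ring
    _ = -∫ z, e z * (wirtingerDeriv φ z * T z + φ z * deriv T z) := by
        simp only [hderiv, add_sub_cancel_left]

theorem integrable_norm_wirtingerDeriv_add_norm {φ : ℂ → ℂ} (hφ : ContDiff ℝ 1 φ)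
    (hc : HasCompactSupport φ) : Integrable fun z => ‖wirtingerDeriv φ z‖ + ‖φ z‖ := by
  refine Integrable.add ?_ (hφ.continuous.integrable_of_hasCompactSupport hc).norm
  refine Integrable.norm ?_
  exact (continuous_wirtingerDeriv hφ).integrable_of_hasCompactSupport <| hc.mono' fun z hz =>
    by_contra fun h => hz (wirtingerDeriv_eq_zero_of_notMem_tsupport h)

theorem norm_integral_fourierChar_re_mul_le {H φ : ℂ → ℂ} (hΩ : IsOpen Ω)
    (hH : DifferentiableOn ℂ H Ω) (hH' : ∀ z ∈ Ω, deriv H z ≠ 0) (hφ : ContDiff ℝ 1 φ)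
    (hc : HasCompactSupport φ) (hsupp : tsupport φ ⊆ Ω) {η : ℝ}
    (hη : ∀ z ∈ tsupport φ, ‖(deriv H z)⁻¹‖ ≤ η)
    (hη' : ∀ z ∈ tsupport φ, ‖deriv (fun w => (deriv H w)⁻¹) z‖ ≤ η) :
    Real.pi * ‖∫ z, 𝐞 (H z).re * φ z‖ ≤ η * ∫ z, (‖wirtingerDeriv φ z‖ + ‖φ z‖) := by
  have hnorm : ‖Real.pi * Complex.I * ∫ z, 𝐞 (H z).re * φ z‖ =
      Real.pi * ‖∫ z, 𝐞 (H z).re * φ z‖ := by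
    simp [abs_of_pos Real.pi_pos]
  rw [← hnorm, integral_fourierChar_re_mul_eq hΩ hH hH' hφ hc hsupp, norm_neg,
    ← integral_const_mul]
  refine norm_integral_le_of_norm_le ((integrable_norm_wirtingerDeriv_add_norm hφ hc).const_mul _)
    (Eventually.of_forall fun z => ?_)
  rw [norm_mul, Circle.norm_coe, one_mul, mul_add, mul_comm _ ‖wirtingerDeriv φ z‖,
    mul_comm _ ‖φ z‖]
  refine (norm_add_le _ _).trans ?_
  rw [norm_mul, norm_mul]
  by_cases hz : z ∈ tsupport φ
  · gcongr
    exacts [hη z hz, hη' z hz]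
  · simp [wirtingerDeriv_eq_zero_of_notMem_tsupport hz, image_eq_zero_of_notMem_tsupport hz]

theorem tendsto_integral_fourierChar_re_mul_of_contDiff {ι : Type*} {l : Filter ι} [l.NeBot]
    {H : ι → ℂ → ℂ} {φ : ℂ → ℂ} (hΩ : IsOpen Ω) (hH : ∀ᶠ a in l, DifferentiableOn ℂ (H a) Ω)
    (hH' : ∀ᶠ a in l, ∀ z ∈ Ω, deriv (H a) z ≠ 0)
    (hlim : TendstoLocallyUniformlyOn (fun a z => (deriv (H a) z)⁻¹) 0 l Ω)
    (hφ : ContDiff ℝ 1 φ) (hc : HasCompactSupport φ) (hsupp : tsupport φ ⊆ Ω) :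
    Tendsto (fun a => ∫ z, 𝐞 (H a z).re * φ z) l (𝓝 0) := by
  have hlim' : TendstoLocallyUniformlyOn (fun a => deriv fun w => (deriv (H a) w)⁻¹) 0 l Ω := by
    have hdiff : ∀ᶠ a in l, DifferentiableOn ℂ (fun z => (deriv (H a) z)⁻¹) Ω := by
      filter_upwards [hH, hH'] with a ha ha' using (ha.deriv hΩ).inv ha'
    simpa [Function.comp_def] using hlim.deriv hdiff hΩ
  have hunif {G : ι → ℂ → ℂ} (hG : TendstoLocallyUniformlyOn G 0 l Ω) {η : ℝ} (hη : 0 < η) :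
      ∀ᶠ a in l, ∀ z ∈ tsupport φ, ‖G a z‖ < η := by
    simpa using Metric.tendstoUniformlyOn_iff.1
      ((tendstoLocallyUniformlyOn_iff_forall_isCompact hΩ).1 hG _ hsupp hc) η hη
  set M : ℝ := ∫ z, (‖wirtingerDeriv φ z‖ + ‖φ z‖)
  have : 0 ≤ M := integral_nonneg fun z => by positivity
  refine Metric.tendsto_nhds.2 fun ε hε => ?_
  have hη : 0 < ε / (M + 1) := by positivity
  filter_upwards [hH, hH', hunif hlim hη, hunif hlim' hη] with a ha ha' hT hT'
  rw [dist_zero_right]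
  calc ‖∫ z, 𝐞 (H a z).re * φ z‖
      ≤ Real.pi * ‖∫ z, 𝐞 (H a z).re * φ z‖ :=
        le_mul_of_one_le_left (norm_nonneg _) (by linarith [Real.pi_gt_three])
    _ ≤ ε / (M + 1) * M :=
        norm_integral_fourierChar_re_mul_le hΩ ha ha' hφ hc hsupp (fun z hz => (hT z hz).le)
          fun z hz => (hT' z hz).le
    _ < ε := by
        rw [div_mul_eq_mul_div, div_lt_iff₀ (by positivity)]
        linarith

theorem exists_contDiff_cutoff {V : Type*} [NormedAddCommGroup V] [NormedSpace ℝ V]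
    [FiniteDimensional ℝ V] {K Ω : Set V} (hK : IsCompact K) (hΩ : IsOpen Ω) (hKΩ : K ⊆ Ω) :
    ∃ χ : V → ℝ, ContDiff ℝ 1 χ ∧ HasCompactSupport χ ∧ tsupport χ ⊆ Ω ∧
      (∀ z, χ z ∈ Set.Icc 0 1) ∧ Set.EqOn χ 1 K := by
  have : ProperSpace V := FiniteDimensional.proper ℝ V
  obtain ⟨L, hL, hKL, hLΩ⟩ := exists_compact_between hK hΩ hKΩ
  obtain ⟨χ, hχ, hrange, hsupp, hone⟩ :=
    exists_contMDiff_support_eq_eq_one_iff (n := 1) 𝓘(ℝ, V) isOpen_interior hK.isClosed hKL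
  have hχL : tsupport χ ⊆ L :=
    closure_minimal (hsupp.trans_subset interior_subset) hL.isClosed
  exact ⟨χ, hχ.contDiff, hL.of_isClosed_subset (isClosed_tsupport χ) hχL, hχL.trans hLΩ,
    fun z => hrange ⟨z, rfl⟩, fun z hz => (hone z).1 hz⟩

theorem exists_contDiff_integral_norm_sub_le {V F : Type*} [NormedAddCommGroup V] [NormedSpace ℝ V]
    [FiniteDimensional ℝ V] [MeasurableSpace V] [BorelSpace V] [NormedAddCommGroup F]
    [NormedSpace ℝ F] {μ : Measure V} [IsFiniteMeasureOnCompacts μ] {ρ : V → F} {Ω : Set V}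
    (hρ : Integrable ρ μ) (hρc : HasCompactSupport ρ) (hΩ : IsOpen Ω) (hρΩ : tsupport ρ ⊆ Ω)
    {ε : ℝ} (hε : 0 < ε) :
    ∃ φ : V → F, ContDiff ℝ 1 φ ∧ HasCompactSupport φ ∧ tsupport φ ⊆ Ω ∧
      ∫ z, ‖ρ z - φ z‖ ∂μ ≤ ε := by
  obtain ⟨g, hgc, hg, hρg⟩ := (memLp_one_iff_integrable.2 hρ).exist_eLpNorm_sub_le
    ENNReal.one_ne_top le_rfl hε
  obtain ⟨χ, hχ, hχc, hχΩ, hχ01, hχρ⟩ := exists_contDiff_cutoff hρc hΩ hρΩ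
  have hgint : Integrable g μ := hg.continuous.integrable_of_hasCompactSupport hgc
  refine ⟨fun z => χ z • g z, hχ.smul (hg.of_le (mod_cast le_top)), hχc.smul_right,
    (closure_mono (Function.support_smul_subset_left χ g)).trans hχΩ, ?_⟩
  have hle (z : V) : ‖ρ z - χ z • g z‖ ≤ ‖(ρ - g) z‖ := by
    have : ρ z - χ z • g z = χ z • (ρ - g) z := by
      by_cases hz : z ∈ tsupport ρ
      · simp [hχρ hz]
      · simp [image_eq_zero_of_notMem_tsupport hz]
    rw [this, norm_smul, Real.norm_of_nonneg (hχ01 z).1]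
    exact mul_le_of_le_one_left (norm_nonneg _) (hχ01 z).2
  calc ∫ z, ‖ρ z - χ z • g z‖ ∂μ
      ≤ ∫ z, ‖(ρ - g) z‖ ∂μ := integral_mono_of_nonneg (Eventually.of_forall fun z => norm_nonneg _)
        (hρ.sub hgint).norm (Eventually.of_forall hle)
    _ = (eLpNorm (ρ - g) 1 μ).toReal := by
        rw [eLpNorm_one_eq_lintegral_enorm, integral_norm_eq_lintegral_enorm
          (hρ.sub hgint).aestronglyMeasurable]
    _ ≤ ε := ENNReal.toReal_le_of_le_ofReal hε.le hρg

theorem integrable_fourierChar_re_mul {H ρ : ℂ → ℂ} (hΩ : IsOpen Ω) (hH : ContinuousOn H Ω)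
    (hρ : Integrable ρ) (hρΩ : Function.support ρ ⊆ Ω) :
    Integrable fun z => 𝐞 (H z).re * ρ z := by
  refine (integrableOn_iff_integrable_of_support_subset (s := Ω) fun z hz =>
    hρΩ (right_ne_zero_of_mul hz)).1 ?_
  refine hρ.integrableOn.bdd_mul (c := 1) (ContinuousOn.aestronglyMeasurable ?_ hΩ.measurableSet)
    (Eventually.of_forall fun z => (Circle.norm_coe _).le)
  exact Real.differentiable_fourierChar.continuous.comp_continuousOn
    (Complex.continuous_re.comp_continuousOn hH)

theorem tendsto_integral_fourierChar_re_mul {ι : Type*} {l : Filter ι} [l.NeBot]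
    {H : ι → ℂ → ℂ} {ρ : ℂ → ℂ} (hΩ : IsOpen Ω)
    (hH : ∀ᶠ a in l, DifferentiableOn ℂ (H a) Ω)
    (hH' : ∀ᶠ a in l, ∀ z ∈ Ω, deriv (H a) z ≠ 0)
    (hlim : TendstoLocallyUniformlyOn (fun a z => (deriv (H a) z)⁻¹) 0 l Ω)
    (hρ : Integrable ρ) (hρc : HasCompactSupport ρ) (hρΩ : tsupport ρ ⊆ Ω) :
    Tendsto (fun a => ∫ z, 𝐞 (H a z).re * ρ z) l (𝓝 0) := by
  refine Metric.tendsto_nhds.2 fun ε hε => ?_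
  obtain ⟨φ, hφ, hφc, hφΩ, hρφ⟩ :=
    exists_contDiff_integral_norm_sub_le hρ hρc hΩ hρΩ (half_pos hε)
  have hφint : Integrable φ := hφ.continuous.integrable_of_hasCompactSupport hφc
  have hmain := tendsto_integral_fourierChar_re_mul_of_contDiff hΩ hH hH' hlim hφ hφc hφΩ
  filter_upwards [Metric.tendsto_nhds.1 hmain _ (half_pos hε), hH] with a ha haH
  have hsub : ∫ z, 𝐞 (H a z).re * (ρ z - φ z) =
      (∫ z, 𝐞 (H a z).re * ρ z) - ∫ z, 𝐞 (H a z).re * φ z := by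
    rw [← integral_sub
      (integrable_fourierChar_re_mul hΩ haH.continuousOn hρ ((subset_tsupport ρ).trans hρΩ))
      (integrable_fourierChar_re_mul hΩ haH.continuousOn hφint ((subset_tsupport φ).trans hφΩ))]
    simp only [mul_sub]
  have hle : ‖∫ z, 𝐞 (H a z).re * (ρ z - φ z)‖ ≤ ε / 2 := by
    refine (norm_integral_le_integral_norm _).trans ?_
    simpa only [norm_mul, Circle.norm_coe, one_mul] using hρφ
  rw [dist_zero_right] at ha ⊢
  calc ‖∫ z, 𝐞 (H a z).re * ρ z‖
      = ‖(∫ z, 𝐞 (H a z).re * (ρ z - φ z)) + ∫ z, 𝐞 (H a z).re * φ z‖ := by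
        rw [hsub, sub_add_cancel]
    _ ≤ _ := norm_add_le _ _
    _ < ε / 2 + ε / 2 := add_lt_add_of_le_of_lt hle ha
    _ = ε := add_halves ε

end NonstationaryPhase

section PuncturedDisc

theorem isOpen_puncturedDisc : IsOpen puncturedDisc :=
  isOpen_ne.inter (isOpen_lt continuous_norm continuous_const)

theorem puncturedDisc_mem_nhdsNE : puncturedDisc ∈ 𝓝[≠] (0 : ℂ) :=
  inter_mem self_mem_nhdsWithin <| nhdsWithin_le_nhds <|
    (isOpen_lt continuous_norm continuous_const).mem_nhds (by simp)

theorem mul_mem_puncturedDisc {a y : ℂ} (ha : a ∈ puncturedDisc) (hy : y ∈ puncturedDisc) :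
    a * y ∈ puncturedDisc :=
  ⟨mul_ne_zero ha.1 hy.1, by
    simpa using mul_lt_one_of_nonneg_of_lt_one_left (norm_nonneg a) ha.2 hy.2.le⟩

theorem eventually_forall_mul_of_eventually_nhdsNE {p : ℂ → Prop} (hp : ∀ᶠ x in 𝓝[≠] 0, p x) :
    ∀ᶠ a in 𝓝[≠] 0, ∀ y ∈ puncturedDisc, p (a * y) := by
  obtain ⟨δ, hδ, hpδ⟩ := Metric.eventually_nhds_iff.1 (eventually_nhdsWithin_iff.1 hp)
  filter_upwards [self_mem_nhdsWithin, nhdsWithin_le_nhds (Metric.ball_mem_nhds 0 hδ)]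
    with a ha0 ha y hy
  refine hpδ ?_ (mul_ne_zero ha0 hy.1)
  rw [dist_zero_right, norm_mul]
  exact (mul_le_of_le_one_right (norm_nonneg a) hy.2.le).trans_lt (by simpa using ha)

theorem tendsto_integral_fourierChar_re_comp_mul {Q ρ : ℂ → ℂ}
    (hQ : DifferentiableOn ℂ Q puncturedDisc)
    (hQ' : Tendsto (fun x => x * deriv Q x) (𝓝[≠] 0) (Bornology.cobounded ℂ))
    (hρ : Integrable ρ) (hρc : HasCompactSupport ρ) (hρD : tsupport ρ ⊆ puncturedDisc) :
    Tendsto (fun a => ∫ y, 𝐞 (Q (a * y)).re * ρ y) (𝓝[≠] 0) (𝓝 0) := by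
  have hderiv (a y : ℂ) : deriv (fun y => Q (a * y)) y = a * deriv Q (a * y) := by
    simpa using deriv_comp_mul_left a Q y
  have hlarge (R : ℝ) : ∀ᶠ a in 𝓝[≠] 0, ∀ y ∈ puncturedDisc,
      R < ‖a * y * deriv Q (a * y)‖ :=
    eventually_forall_mul_of_eventually_nhdsNE
      ((tendsto_norm_atTop_iff_cobounded.2 hQ').eventually_gt_atTop R)
  refine tendsto_integral_fourierChar_re_mul (H := fun a y => Q (a * y)) isOpen_puncturedDisc
    ?_ ?_ (TendstoUniformlyOn.tendstoLocallyUniformlyOn ?_) hρ hρc hρD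
  · filter_upwards [puncturedDisc_mem_nhdsNE] with a ha
    exact hQ.comp (by fun_prop) fun y hy => mul_mem_puncturedDisc ha hy
  · filter_upwards [hlarge 0] with a ha y hy h0
    rw [hderiv] at h0
    have hpos := ha y hy
    rw [mul_right_comm, h0, zero_mul, norm_zero] at hpos
    exact hpos.false
  · refine Metric.tendstoUniformlyOn_iff.2 fun ε hε => ?_
    filter_upwards [hlarge ε⁻¹, self_mem_nhdsWithin] with a ha ha0 y hy
    have hscale : (a * deriv Q (a * y))⁻¹ = y * (a * y * deriv Q (a * y))⁻¹ := by
      have : a ≠ 0 := ha0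
      have : y ≠ 0 := hy.1
      field_simp
    rw [Pi.zero_apply, dist_zero_left, hderiv, hscale, norm_mul, norm_inv]
    calc ‖y‖ * ‖a * y * deriv Q (a * y)‖⁻¹
        ≤ ‖a * y * deriv Q (a * y)‖⁻¹ := mul_le_of_le_one_left (by positivity) hy.2.le
      _ < ε := inv_lt_of_inv_lt₀ hε (ha y hy)

end PuncturedDisc

section HaarOnTranslate

variable {K T : Type*} [AddCommGroup K] [TopologicalSpace K] [MeasurableSpace K] [BorelSpace K]
  [AddCommGroup T] [TopologicalSpace T] [MeasurableSpace T] [BorelSpace T]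
  (μ : Measure K) [IsProbabilityMeasure μ] [μ.IsAddLeftInvariant]
  {φ : K →+ T} (hφ : Continuous φ) (p : T)

include hφ

theorem isHaarProbabilityOn_map [ContinuousAdd K] [CompactSpace K] [ContinuousAdd T] [T2Space T] :
    IsHaarProbabilityOn (μ.map fun θ => p + φ θ) (Set.range fun θ => p + φ θ) := by
  have hc : Continuous fun θ => p + φ θ := by fun_prop
  refine ⟨Measure.isProbabilityMeasure_map hc.aemeasurable, ?_, fun t ht => ?_⟩
  · rw [Measure.map_apply hc.measurable (isCompact_range hc).isClosed.measurableSet.compl,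
      Set.preimage_compl, Set.preimage_range, Set.compl_univ, measure_empty]
  · obtain ⟨η, hη⟩ : t + p ∈ Set.range fun θ => p + φ θ :=
      ht ▸ Set.mem_image_of_mem _ ⟨0, by simp only [map_zero, add_zero]⟩
    obtain rfl : φ η = t := add_left_cancel (hη.trans (add_comm t p))
    have hcomm : (fun s => φ η + s) ∘ (fun θ => p + φ θ) =
        (fun θ => p + φ θ) ∘ fun θ => η + θ := by
      funext θ
      simp only [Function.comp_apply, map_add, add_left_comm]
    rw [Measure.map_map (by fun_prop) hc.measurable, hcomm,
      ← Measure.map_map hc.measurable (by fun_prop), map_add_left_eq_self]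

theorem IsHaarProbabilityOn.eq_map [ContinuousAdd K] [ContinuousAdd T] [MeasurableAdd₂ T]
    {ν : Measure T} (hν : IsHaarProbabilityOn ν (Set.range fun θ => p + φ θ)) :
    ν = μ.map fun θ => p + φ θ := by
  have := hν.prob
  have hinv (η : K) : ν.map (fun s => φ η + s) = ν := by
    refine hν.invariant (φ η) ?_
    rw [← Set.range_comp, ← (Equiv.addLeft η).surjective.range_comp fun θ => p + φ θ]
    refine congrArg Set.range (funext fun θ => ?_)
    simp only [Function.comp_apply, Equiv.coe_addLeft, map_add, add_left_comm]
  refine Measure.ext_of_lintegral _ fun h hh => ?_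
  calc ∫⁻ t, h t ∂ν
      = ∫⁻ θ, ∫⁻ t, h (φ θ + t) ∂ν ∂μ := by
        have (θ : K) : ∫⁻ t, h (φ θ + t) ∂ν = ∫⁻ t, h t ∂ν := by
          rw [← lintegral_map (f := h) hh (by fun_prop), hinv]
        simp only [this, lintegral_const, measure_univ, mul_one]
    _ = ∫⁻ t, ∫⁻ θ, h (φ θ + t) ∂μ ∂ν :=
        lintegral_lintegral_swap (hh.comp ((hφ.measurable.comp measurable_fst).add
          measurable_snd)).aemeasurable
    _ = ∫⁻ _, ∫⁻ θ, h (p + φ θ) ∂μ ∂ν := by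
        refine lintegral_congr_ae ?_
        have hcarried : ∀ᵐ t ∂ν, t ∈ Set.range fun θ => p + φ θ := hν.carried
        filter_upwards [hcarried]
        rintro _ ⟨η, rfl⟩
        rw [← lintegral_add_left_eq_self (fun θ => h (p + φ θ)) η]
        simp only [map_add, add_left_comm, add_comm]
    _ = ∫⁻ t, h t ∂(μ.map fun θ => p + φ θ) := by
        rw [lintegral_const, measure_univ, mul_one, lintegral_map hh (by fun_prop)]

end HaarOnTranslate

section WeylCriterion

theorem norm_integral_comp_mul_sub_le {X K : Type*} [MeasurableSpace X] {ν : Measure X}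
    [TopologicalSpace K] [CompactSpace K] [MeasurableSpace K] [BorelSpace K]
    {ρ : X → ℂ} (hρ : Integrable ρ ν) {u : X → K} (hu : AEMeasurable u ν) (G G' : C(K, ℂ)) :
    ‖∫ y, G (u y) * ρ y ∂ν - ∫ y, G' (u y) * ρ y ∂ν‖ ≤ ‖G - G'‖ * ∫ y, ‖ρ y‖ ∂ν := by
  have hint (H : C(K, ℂ)) : Integrable (fun y => H (u y) * ρ y) ν :=
    hρ.bdd_mul (H.continuous.measurable.comp_aemeasurable hu).aestronglyMeasurable
      (Eventually.of_forall fun y => H.norm_coe_le_norm (u y))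
  rw [← integral_sub (hint G) (hint G'), ← integral_const_mul]
  refine norm_integral_le_of_norm_le (hρ.norm.const_mul _) (Eventually.of_forall fun y => ?_)
  rw [← sub_mul, norm_mul]
  exact mul_le_mul_of_nonneg_right ((G - G').norm_coe_le_norm _) (norm_nonneg _)

variable {ι : Type*} [Fintype ι]

theorem mFourier_coe (n : ι → ℤ) (t : ι → ℝ) :
    UnitAddTorus.mFourier n (fun i => (t i : UnitAddCircle)) = 𝐞 (∑ i, n i * t i) := by
  simp only [UnitAddTorus.mFourier, ContinuousMap.coe_mk, fourier_coe_apply, ← Complex.exp_sum,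
    Real.fourierChar_apply, Complex.ofReal_one, div_one, Complex.ofReal_ofNat,
    Complex.ofReal_sum, Complex.ofReal_mul,
    Complex.ofReal_intCast, Finset.mul_sum, Finset.sum_mul]
  exact congrArg Complex.exp (Finset.sum_congr rfl fun i _ => by ring)

theorem mFourier_add_apply (n : ι → ℤ) (s t : UnitAddTorus ι) :
    UnitAddTorus.mFourier n (s + t) = UnitAddTorus.mFourier n s * UnitAddTorus.mFourier n t := by
  simp only [UnitAddTorus.mFourier, ContinuousMap.coe_mk, fourier_apply, Pi.add_apply, smul_add,
    AddCircle.toCircle_add, Circle.coe_mul, Finset.prod_mul_distrib]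

theorem integral_mFourier_eq_zero (μ : Measure (UnitAddTorus ι)) [μ.IsAddLeftInvariant]
    {n : ι → ℤ} (hn : n ≠ 0) : ∫ t, UnitAddTorus.mFourier n t ∂μ = 0 := by
  classical
  obtain ⟨i, hi⟩ := Function.ne_iff.1 hn
  have hi' : (n i : ℝ) ≠ 0 := Int.cast_ne_zero.2 hi
  -- translating the `i`-th coordinate by `1 / (2 nᵢ)` changes the sign of the character
  let h : ι → ℝ := Pi.single i (1 / (2 * n i))
  refine integral_eq_zero_of_add_left_eq_neg (g := fun j => (h j : UnitAddCircle)) fun t => ?_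
  have hsum : ∑ j, (n j : ℝ) * h j = 1 / 2 := by
    simp only [h, Pi.single_apply, mul_ite, mul_zero, Finset.sum_ite_eq', Finset.mem_univ, if_true]
    field_simp
  have hexp : (2 * Real.pi * (1 / 2) : ℝ) * Complex.I = Real.pi * Complex.I := by
    push_cast; ring
  rw [mFourier_add_apply, mFourier_coe, hsum, Real.fourierChar_apply, hexp, Complex.exp_pi_mul_I,
    neg_one_mul]

variable {α X : Type*} [MeasurableSpace X] {ν : Measure X} {l : Filter α} {ρ : X → ℂ}
  (hρ : Integrable ρ ν)

include hρ

theorem tendsto_integral_comp_mul_of_mem_closure {K : Type*} [TopologicalSpace K] [CompactSpace K]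
    [MeasurableSpace K] [BorelSpace K] (μ : Measure K) [IsProbabilityMeasure μ] {u : α → X → K}
    (hu : ∀ᶠ a in l, AEMeasurable (u a) ν) {S : Set C(K, ℂ)}
    (hS : ∀ G ∈ S, Tendsto (fun a => ∫ y, G (u a y) * ρ y ∂ν) l
      (𝓝 ((∫ t, G t ∂μ) * ∫ y, ρ y ∂ν))) {G : C(K, ℂ)} (hG : G ∈ closure S) :
    Tendsto (fun a => ∫ y, G (u a y) * ρ y ∂ν) l (𝓝 ((∫ t, G t ∂μ) * ∫ y, ρ y ∂ν)) := by
  have := mem_closure_iff_nhdsWithin_neBot.1 hG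
  have hzero (C : ℝ) : Tendsto (fun G' => ‖G - G'‖ * C) (𝓝 G) (𝓝 0) :=
    Continuous.tendsto' (by fun_prop) _ _ (by simp)
  refine TendstoUniformlyOnFilter.tendsto_of_eventually_tendsto
    (p := 𝓝[S] G)
    (F := fun G' a => ∫ y, G' (u a y) * ρ y ∂ν) ?_
    (eventually_mem_nhdsWithin.mono hS) ?_
  · refine Metric.tendstoUniformlyOnFilter_iff.2 fun ε hε => ?_
    filter_upwards [((hzero (∫ y, ‖ρ y‖ ∂ν)).mono_left nhdsWithin_le_nhds).eventually_lt_const hε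
      |>.prod_mk hu] with ⟨G', a⟩ ⟨hG', ha⟩
    rw [dist_eq_norm]
    exact (norm_integral_comp_mul_sub_le hρ ha G G').trans_lt hG'
  · refine Tendsto.mul_const _ (Tendsto.mono_left ?_ nhdsWithin_le_nhds)
    refine tendsto_iff_norm_sub_tendsto_zero.2 (squeeze_zero (fun _ => norm_nonneg _)
      (fun G' => ?_) (hzero (∫ _, ‖(1 : ℂ)‖ ∂μ)))
    rw [norm_sub_rev]
    simpa only [id, mul_one] using norm_integral_comp_mul_sub_le (integrable_const 1)
      aemeasurable_id G G'

theorem tendsto_integral_comp_mul_of_mFourier (μ : Measure (UnitAddTorus ι))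
    [IsProbabilityMeasure μ] [μ.IsAddLeftInvariant] {u : α → X → UnitAddTorus ι}
    (hu : ∀ᶠ a in l, AEMeasurable (u a) ν)
    (hchar : ∀ n : ι → ℤ, n ≠ 0 →
      Tendsto (fun a => ∫ y, UnitAddTorus.mFourier n (u a y) * ρ y ∂ν) l (𝓝 0))
    (G : C(UnitAddTorus ι, ℂ)) :
    Tendsto (fun a => ∫ y, G (u a y) * ρ y ∂ν) l (𝓝 ((∫ t, G t ∂μ) * ∫ y, ρ y ∂ν)) := by
  have hint (H : C(UnitAddTorus ι, ℂ)) : Integrable H μ :=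
    (integrable_const ‖H‖).mono' H.continuous.aestronglyMeasurable
      (Eventually.of_forall H.norm_coe_le_norm)
  have hint' (H : C(UnitAddTorus ι, ℂ)) {a : α} (ha : AEMeasurable (u a) ν) :
      Integrable (fun y => H (u a y) * ρ y) ν :=
    hρ.bdd_mul (H.continuous.measurable.comp_aemeasurable ha).aestronglyMeasurable
      (Eventually.of_forall fun y => H.norm_coe_le_norm (u a y))
  have hdense := Submodule.dense_iff_topologicalClosure_eq_top.2
    (UnitAddTorus.span_mFourier_closure_eq_top (d := ι))
  refine tendsto_integral_comp_mul_of_mem_closure hρ μ hu (fun H hH => ?_) (hdense G)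
  induction hH using Submodule.span_induction with
  | mem H hH =>
    obtain ⟨n, rfl⟩ := hH
    by_cases hn : n = 0
    · simp only [hn, UnitAddTorus.mFourier_zero, ContinuousMap.one_apply, one_mul,
        integral_const, measureReal_def, measure_univ, ENNReal.toReal_one, one_smul,
        tendsto_const_nhds]
    · simpa only [integral_mFourier_eq_zero μ hn, zero_mul] using hchar n hn
  | zero =>
    simp only [ContinuousMap.zero_apply, zero_mul, integral_zero, tendsto_const_nhds]
  | add H H' _ _ h h' =>
    simp only [ContinuousMap.add_apply]
    rw [integral_add (hint H) (hint H'), add_mul]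
    refine (h.add h').congr' ?_
    filter_upwards [hu] with a ha
    simp only [add_mul]
    rw [integral_add (hint' H ha) (hint' H' ha)]
  | smul z H _ h =>
    simp only [ContinuousMap.smul_apply, smul_eq_mul, mul_assoc, integral_const_mul]
    exact h.const_mul z

end WeylCriterion

section RationalFrame

theorem span_range_inf_ker_le {𝕜 M ι : Type*} [Field 𝕜] [AddCommGroup M] [Module 𝕜 M]
    (b : ι → M) (ξ : M →ₗ[𝕜] 𝕜) {j : ι} (hj : ξ (b j) ≠ 0) :
    Submodule.span 𝕜 (Set.range b) ⊓ LinearMap.ker ξ ≤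
      Submodule.span 𝕜 (Set.range fun i => ξ (b j) • b i - ξ (b i) • b j) := by
  rintro w ⟨hw, hξw⟩
  let P : M →ₗ[𝕜] M := ξ (b j) • LinearMap.id - ξ.smulRight (b j)
  have hPw : P w = ξ (b j) • w := by
    simp only [P, LinearMap.sub_apply, LinearMap.smul_apply, LinearMap.id_apply,
      LinearMap.smulRight_apply, LinearMap.mem_ker.1 hξw, zero_smul, sub_zero]
  rw [← inv_smul_smul₀ hj w, ← hPw]
  refine Submodule.smul_mem _ _ ?_
  have hmap := Submodule.mem_map_of_mem (f := P) hw
  rwa [Submodule.map_span, ← Set.range_comp] at hmap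

variable {E : Type*} [NormedAddCommGroup E] [NormedSpace ℝ E]

theorem exists_coord_of_linearIndependent {ι : Type*} [Finite ι] {b : ι → E}
    (hb : LinearIndependent ℝ b) :
    ∃ l : ι → E →L[ℝ] ℝ, ∀ i j, l i (b j) = Finsupp.single j 1 i := by
  let B := Module.Basis.span hb
  have : FiniteDimensional ℝ (Submodule.span ℝ (Set.range b)) := B.finiteDimensional_of_finite
  obtain ⟨P, hP⟩ := Submodule.ClosedComplemented.of_finiteDimensional
    (Submodule.span ℝ (Set.range b))
  refine ⟨fun i => (B.coord i).toContinuousLinearMap ∘L P, fun i j => ?_⟩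
  have hPb : P (b j) = B j := by
    rw [hP ⟨b j, Submodule.subset_span ⟨j, rfl⟩⟩, Subtype.ext_iff, Module.Basis.span_apply]
  simp only [ContinuousLinearMap.comp_apply, LinearMap.coe_toContinuousLinearMap', hPb,
    Module.Basis.coord_apply, Module.Basis.repr_self]

/-- A linearly independent family in `Γ`, with dual coordinates, whose span contains `F`, such
that no non-trivial integral combination of the coordinates vanishes on `F`. In other words, its
span is the smallest real subspace defined over `Γ` that contains `F`. -/
structure RationalFrame (Γ : AddSubgroup E) (F : Submodule ℝ E) (ι : Type*) [Fintype ι] where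
  vec : ι → E
  coord : ι → E →L[ℝ] ℝ
  vec_mem : ∀ i, vec i ∈ Γ
  coord_vec : ∀ i j, coord i (vec j) = Finsupp.single j 1 i
  le_span : F ≤ Submodule.span ℝ (Set.range vec)
  exists_ne_zero : ∀ n : ι → ℤ, n ≠ 0 → ∃ u ∈ F, ∑ i, n i * coord i u ≠ 0

theorem exists_finset_minimal_finrank_span {Γ : AddSubgroup E} {F : Submodule ℝ E}
    [FiniteDimensional ℝ F] (hF : F ≤ Submodule.span ℝ Γ) :
    ∃ S : Finset E, (S : Set E) ⊆ Γ ∧ F ≤ Submodule.span ℝ (S : Set E) ∧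
      ∀ S' : Finset E, (S' : Set E) ⊆ Γ → F ≤ Submodule.span ℝ (S' : Set E) →
        Module.finrank ℝ (Submodule.span ℝ (S : Set E)) ≤
          Module.finrank ℝ (Submodule.span ℝ (S' : Set E)) := by
  have hex : ∃ S : Finset E, (S : Set E) ⊆ Γ ∧ F ≤ Submodule.span ℝ (S : Set E) := by
    obtain ⟨t, rfl⟩ := (Submodule.fg_iff_finiteDimensional F).2 ‹_›
    obtain ⟨S, hSΓ, htS⟩ := Submodule.subset_span_finite_of_subset_span
      (Submodule.span_le.1 hF)
    exact ⟨S, hSΓ, Submodule.span_le.2 htS⟩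
  obtain ⟨S, ⟨hSΓ, hFS⟩, hmin⟩ := exists_minimalFor_of_wellFoundedLT _
    (fun S : Finset E => Module.finrank ℝ (Submodule.span ℝ (S : Set E))) hex
  exact ⟨S, hSΓ, hFS, fun S' hS'Γ hFS' => (le_total _ _).elim id (hmin ⟨hS'Γ, hFS'⟩)⟩

theorem exists_minimal_family {Γ : AddSubgroup E} {F : Submodule ℝ E} [FiniteDimensional ℝ F]
    (hF : F ≤ Submodule.span ℝ Γ) :
    ∃ (m : ℕ) (b : Fin m → E), LinearIndependent ℝ b ∧ (∀ i, b i ∈ Γ) ∧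
      F ≤ Submodule.span ℝ (Set.range b) ∧
      ∀ (ξ : E →ₗ[ℝ] ℝ) (n : Fin m → ℤ), (∀ i, ξ (b i) = n i) → F ≤ LinearMap.ker ξ → n = 0 := by
  classical
  obtain ⟨S, hSΓ, hFS, hmin⟩ := exists_finset_minimal_finrank_span hF
  obtain ⟨b, hbS, hbspan, hb⟩ := Submodule.exists_fun_fin_finrank_span_eq ℝ (S : Set E)
  refine ⟨_, b, hb, fun i => hSΓ (hbS i), hFS.trans hbspan.ge, fun ξ n hξ hFξ => ?_⟩
  by_contra hn
  obtain ⟨j, hj⟩ := Function.ne_iff.1 hn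
  have hξj : ξ (b j) ≠ 0 := by
    rw [hξ]
    exact Int.cast_ne_zero.2 hj
  -- `F` lies in the span of the vectors `ξ (b j) • b i - ξ (b i) • b j` of `Γ`, which is smaller
  let S' : Finset E := Finset.univ.image fun i => n j • b i - n i • b j
  have hS' : (S' : Set E) = Set.range fun i => ξ (b j) • b i - ξ (b i) • b j := by
    simp only [S', Finset.coe_image, Finset.coe_univ, Set.image_univ, hξ, Int.cast_smul_eq_zsmul]
  have hle : Submodule.span ℝ (S' : Set E) ≤ Submodule.span ℝ (S : Set E) ⊓ LinearMap.ker ξ := by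
    rw [hS', Submodule.span_le]
    rintro _ ⟨i, rfl⟩
    refine ⟨sub_mem (Submodule.smul_mem _ _ (Submodule.subset_span (hbS i)))
      (Submodule.smul_mem _ _ (Submodule.subset_span (hbS j))), ?_⟩
    simp only [SetLike.mem_coe, LinearMap.mem_ker, map_sub, map_smul, smul_eq_mul]
    ring
  have hlt : Submodule.span ℝ (S' : Set E) < Submodule.span ℝ (S : Set E) :=
    lt_of_le_of_ne (hle.trans inf_le_left) fun h =>
      hξj (LinearMap.mem_ker.1 ((h ▸ hle) (Submodule.subset_span (hbS j))).2)
  refine (Submodule.finrank_lt_finrank_of_lt hlt).not_ge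
    (hmin S' ?_ ?_)
  · simp only [S', Finset.coe_image, Set.image_subset_iff]
    exact fun i _ => sub_mem (zsmul_mem (hSΓ (hbS i)) _) (zsmul_mem (hSΓ (hbS j)) _)
  · rw [hS']
    exact (le_inf (hFS.trans hbspan.ge) hFξ).trans (span_range_inf_ker_le b ξ hξj)

theorem exists_rationalFrame {Γ : AddSubgroup E} {F : Submodule ℝ E} [FiniteDimensional ℝ F]
    (hF : F ≤ Submodule.span ℝ Γ) : ∃ m, Nonempty (RationalFrame Γ F (Fin m)) := by
  obtain ⟨m, b, hb, hbΓ, hFb, hmin⟩ := exists_minimal_family hF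
  obtain ⟨l, hl⟩ := exists_coord_of_linearIndependent hb
  refine ⟨m, ⟨b, l, hbΓ, hl, hFb, fun n hn => ?_⟩⟩
  by_contra! hzero
  refine hn (hmin (∑ i, (n i : ℝ) • (l i : E →ₗ[ℝ] ℝ)) n (fun j => ?_) fun u hu => ?_)
  · simp [hl, Finsupp.single_apply]
  · simpa using hzero u hu

theorem RationalFrame.sum_coord_smul_vec {Γ : AddSubgroup E} {F : Submodule ℝ E} {ι : Type*}
    [Fintype ι] (R : RationalFrame Γ F ι) {u : E}
    (hu : u ∈ Submodule.span ℝ (Set.range R.vec)) : ∑ i, R.coord i u • R.vec i = u := by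
  classical
  obtain ⟨t, rfl⟩ := (Submodule.mem_span_range_iff_exists_fun ℝ).1 hu
  simp only [map_sum, map_smul, R.coord_vec, Finsupp.single_apply, smul_eq_mul, mul_ite, mul_one,
    mul_zero, Finset.sum_ite_eq', Finset.mem_univ, if_true]

end RationalFrame

section TorusHom

variable {E : Type*} [AddCommGroup E] [Module ℝ E] (Γ : AddSubgroup E)

theorem le_of_image_coe_subset [Countable Γ] {F W : Submodule ℝ E} {c c' : E}
    (h : ((↑) : E → E ⧸ Γ) '' (AffineSubspace.mk' c F : Set E) ⊆
      (↑) '' (AffineSubspace.mk' c' W : Set E)) : F ≤ W := by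
  intro x hx
  have hline (t : ℝ) : ∃ γ : Γ, c + t • x + γ - c' ∈ W := by
    obtain ⟨w, hw, hwt⟩ := h ⟨c + t • x, by simpa using F.smul_mem t hx, rfl⟩
    refine ⟨⟨-(c + t • x) + w, QuotientAddGroup.eq.1 hwt.symm⟩, ?_⟩
    rw [add_neg_cancel_left]
    exact AffineSubspace.mem_mk'.1 hw
  choose γ hγ using hline
  -- two points of the line `ℝ x` are carried into `W` by the same element of the countable `Γ`
  obtain ⟨s, t, hst, hne⟩ : ∃ s t, γ s = γ t ∧ s ≠ t := by
    simpa [Function.Injective] using not_injective_uncountable_countable γ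
  have hsub := W.sub_mem (hγ s) (hγ t)
  rw [hst, sub_sub_sub_cancel_right, add_sub_add_right_eq_sub, add_sub_add_left_eq_sub,
    ← sub_smul] at hsub
  exact (W.smul_mem_iff (sub_ne_zero.2 hne)).1 hsub

/-- The homomorphism `ℝ / ℤ → E / Γ` induced by `t ↦ t • e`, for `e ∈ Γ`. -/
def circleHom (e : E) (he : e ∈ Γ) : UnitAddCircle →+ E ⧸ Γ :=
  QuotientAddGroup.map _ Γ (LinearMap.toSpanSingleton ℝ E e).toAddMonoidHom
    (AddSubgroup.zmultiples_le.2 (by simpa using he))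

variable {ι : Type*} [Fintype ι] {b : ι → E} (hb : ∀ i, b i ∈ Γ)

/-- The homomorphism `(ℝ / ℤ)^ι → E / Γ` induced by `t ↦ ∑ i, t i • b i`, for a family `b` in
`Γ`. -/
def torusHom : UnitAddTorus ι →+ E ⧸ Γ :=
  ∑ i, (circleHom Γ (b i) (hb i)).comp (Pi.evalAddMonoidHom _ i)

theorem torusHom_coe (t : ι → ℝ) :
    torusHom Γ hb (fun i => (t i : UnitAddCircle)) = ((∑ i, t i • b i : E) : E ⧸ Γ) := by
  simp only [torusHom, AddMonoidHom.finsetSum_apply, AddMonoidHom.comp_apply,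
    Pi.evalAddMonoidHom_apply]
  exact (map_sum (QuotientAddGroup.mk' Γ) _ _).symm

theorem range_coe_add_torusHom (c : E) :
    (Set.range fun θ => (c : E ⧸ Γ) + torusHom Γ hb θ) =
      (↑) '' (AffineSubspace.mk' c (Submodule.span ℝ (Set.range b)) : Set E) := by
  ext s
  constructor
  · rintro ⟨θ, rfl⟩
    choose t ht using fun i => QuotientAddGroup.mk_surjective (θ i)
    obtain rfl : (fun i => (t i : UnitAddCircle)) = θ := funext ht
    refine ⟨c + ∑ i, t i • b i, ?_, ?_⟩
    · rw [SetLike.mem_coe, AffineSubspace.mem_mk', vsub_eq_sub, add_sub_cancel_left]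
      exact (Submodule.mem_span_range_iff_exists_fun ℝ).2 ⟨t, rfl⟩
    · simp only [torusHom_coe, QuotientAddGroup.mk_add]
  · rintro ⟨x, hx, rfl⟩
    obtain ⟨t, ht⟩ := Submodule.mem_span_range_iff_exists_fun ℝ |>.1
      (AffineSubspace.mem_mk'.1 hx)
    refine ⟨fun i => (t i : UnitAddCircle), ?_⟩
    simp only [torusHom_coe, ht, vsub_eq_sub, ← QuotientAddGroup.mk_add, add_sub_cancel]

theorem continuous_torusHom [TopologicalSpace E] [IsTopologicalAddGroup E]
    [ContinuousSMul ℝ E] :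
    Continuous (torusHom Γ hb) := by
  have hcircle (i : ι) : Continuous (circleHom Γ (b i) (hb i)) :=
    Continuous.quotient_lift (QuotientAddGroup.continuous_mk.comp
      (LinearMap.toSpanSingleton ℝ E (b i)).continuous_of_finiteDimensional) _
  simp only [torusHom, AddMonoidHom.coe_finsetSum, AddMonoidHom.coe_comp]
  rw [Finset.sum_fn]
  exact continuous_finsetSum _ fun i _ => (hcircle i).comp (continuous_apply i)

end TorusHom

section AsymptoticallyEqual

variable {X T : Type*} [AddCommGroup T] [TopologicalSpace T] [IsTopologicalAddGroup T]
  {l : Filter X} {u w : X → T}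

theorem mapClusterPt_of_tendsto_sub {p : T} (hu : MapClusterPt p l u)
    (huw : Tendsto (fun x => w x - u x) l (𝓝 0)) : MapClusterPt p l w := by
  rw [mapClusterPt_iff_ultrafilter] at hu ⊢
  obtain ⟨V, hV, h⟩ := hu
  exact ⟨V, hV, by simpa using h.add (huw.mono_left hV)⟩

theorem mem_of_mapClusterPt_of_tendsto_sub {p : T} {S : Set T} (hS : IsClosed S)
    (hp : MapClusterPt p l u) (huw : Tendsto (fun x => u x - w x) l (𝓝 0))
    (hw : ∀ᶠ x in l, w x ∈ S) : p ∈ S := by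
  have hp' := mapClusterPt_of_tendsto_sub hp (w := w) (by simpa using huw.neg)
  obtain ⟨V, hV, h⟩ := mapClusterPt_iff_ultrafilter.1 hp'
  exact hS.mem_of_tendsto h (hV hw)

theorem tendsto_comp_sub_of_tendsto_sub {K : Set T} (hK : IsCompact K) (hw : ∀ x, w x ∈ K)
    (huw : Tendsto (fun x => u x - w x) l (𝓝 0)) {g : T → ℝ} (hg : Continuous g) :
    Tendsto (fun x => g (u x) - g (w x)) l (𝓝 0) := by
  rw [tendsto_iff_ultrafilter]
  intro V hV
  obtain ⟨p, -, hp⟩ := hK.ultrafilter_le_nhds (V.map w) (le_principal_iff.2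
    (Ultrafilter.mem_map.2 (univ_mem' hw)))
  have hw' : Tendsto w V (𝓝 p) := hp
  have hu : Tendsto u V (𝓝 p) := by simpa using hw'.add (huw.mono_left hV)
  simpa using ((hg.tendsto p).comp hu).sub ((hg.tendsto p).comp hw')

end AsymptoticallyEqual

section RescaledIntegrals

variable {U : Set ℂ} (hU : MeasurableSet U) (hUD : U ⊆ puncturedDisc)

include hU hUD

theorem aestronglyMeasurable_comp_mul {Y : Type*} [TopologicalSpace Y]
    [TopologicalSpace.PseudoMetrizableSpace Y] {F : ℂ → Y}
    (hF : ContinuousOn F puncturedDisc) {a : ℂ}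
    (ha : a ∈ puncturedDisc) :
    AEStronglyMeasurable (fun y => F (a * y)) (volume.restrict U) :=
  (hF.comp (continuous_const_mul a).continuousOn
    fun _ hy => mul_mem_puncturedDisc ha (hUD hy)).aestronglyMeasurable hU

variable {ρ : ℂ → ℝ} (hρ : IntegrableOn ρ U)

include hρ

theorem tendsto_setIntegral_comp_mul_of_tendsto_zero {q : ℂ → ℝ}
    (hq : Tendsto q (𝓝[≠] 0) (𝓝 0)) :
    Tendsto (fun a => ∫ y in U, q (a * y) * ρ y) (𝓝[≠] 0) (𝓝 0) := by
  have hlittleO : (fun a => ∫ y in U, q (a * y) * ρ y) =o[𝓝[≠] 0] fun _ => ∫ y in U, ‖ρ y‖ := by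
    refine IsLittleO.of_bound fun ε hε => ?_
    filter_upwards [eventually_forall_mul_of_eventually_nhdsNE
      (hq.norm.eventually_le_const (norm_zero.trans_lt hε))] with a ha
    rw [Real.norm_of_nonneg (integral_nonneg fun y => norm_nonneg _), ← integral_const_mul]
    refine norm_integral_le_of_norm_le (hρ.norm.const_mul ε) ?_
    filter_upwards [ae_restrict_mem hU] with y hy
    rw [norm_mul]
    exact mul_le_mul_of_nonneg_right (ha y (hUD hy)) (norm_nonneg _)
  exact (isLittleO_one_iff ℝ).1 (hlittleO.trans_isBigO (isBigO_const_const _ one_ne_zero _))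

theorem tendsto_setIntegral_comp_mul_of_tendsto_sub {q q' : ℂ → ℝ} {C L : ℝ}
    (hq : ContinuousOn q puncturedDisc) (hq' : ContinuousOn q' puncturedDisc)
    (hC : ∀ x, ‖q' x‖ ≤ C) (hsub : Tendsto (fun x => q x - q' x) (𝓝[≠] 0) (𝓝 0))
    (hlim : Tendsto (fun a => ∫ y in U, q' (a * y) * ρ y) (𝓝[≠] 0) (𝓝 L)) :
    Tendsto (fun a => ∫ y in U, q (a * y) * ρ y) (𝓝[≠] 0) (𝓝 L) := by
  have hsum := (tendsto_setIntegral_comp_mul_of_tendsto_zero hU hUD hρ hsub).add hlim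
  rw [zero_add] at hsum
  refine hsum.congr' ?_
  filter_upwards [puncturedDisc_mem_nhdsNE, eventually_forall_mul_of_eventually_nhdsNE
    (hsub.norm.eventually_le_const (norm_zero.trans_lt one_pos))] with a ha ha'
  rw [← integral_add]
  · simp only [← add_mul, sub_add_cancel]
  · refine hρ.bdd_mul (c := 1) (aestronglyMeasurable_comp_mul hU hUD (hq.sub hq') ha) ?_
    filter_upwards [ae_restrict_mem hU] with y hy using ha' y (hUD hy)
  · exact hρ.bdd_mul (aestronglyMeasurable_comp_mul hU hUD hq' ha)
      (Eventually.of_forall fun y => hC _)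

end RescaledIntegrals

section TorusCurves

variable {ι : Type*}

/-- The curve in the torus `(ℝ / ℤ)^ι` covered by `θ`. -/
def torusCurve (θ : ℂ → ι → ℝ) (x : ℂ) : UnitAddTorus ι := fun i => (θ x i : UnitAddCircle)

theorem continuousOn_torusCurve {θ : ℂ → ι → ℝ} {S : Set ℂ} (hθ : ContinuousOn θ S) :
    ContinuousOn (torusCurve θ) S :=
  continuousOn_pi.2 fun i =>
    (AddCircle.continuous_mk' 1).comp_continuousOn (continuousOn_pi.1 hθ i)

variable [Fintype ι]

/-- Every non-trivial integral combination of the coordinates of `θ` is the real part of a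
holomorphic function `Q` with a singularity at `0` strong enough for `x Q'(x)` to tend to infinity.
This is the condition on the phases of the characters of `(ℝ / ℤ)^ι` along `θ` that makes the
rescaled curve equidistribute. -/
def HasPolarCharacters (θ : ℂ → ι → ℝ) : Prop :=
  ∀ n : ι → ℤ, n ≠ 0 → ∃ Q : ℂ → ℂ, DifferentiableOn ℂ Q puncturedDisc ∧
    Tendsto (fun x => x * deriv Q x) (𝓝[≠] 0) (Bornology.cobounded ℂ) ∧
    ∀ x, (Q x).re = ∑ i, n i * θ x i

variable {θ : ℂ → ι → ℝ} {U : Set ℂ}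

theorem mFourier_torusCurve (n : ι → ℤ) (x : ℂ) :
    UnitAddTorus.mFourier n (torusCurve θ x) = 𝐞 (∑ i, n i * θ x i) :=
  mFourier_coe n (θ x)

theorem tendsto_setIntegral_fourierChar_re_comp_mul (hU : MeasurableSet U)
    (hUD : closure U ⊆ puncturedDisc) {Q : ℂ → ℂ}
    (hQ : DifferentiableOn ℂ Q puncturedDisc)
    (hQ' : Tendsto (fun x => x * deriv Q x) (𝓝[≠] 0) (Bornology.cobounded ℂ)) {ρ : ℂ → ℂ}
    (hρ : IntegrableOn ρ U) :
    Tendsto (fun a => ∫ y in U, 𝐞 (Q (a * y)).re * ρ y) (𝓝[≠] 0) (𝓝 0) := by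
  have hUb : Bornology.IsBounded U := (Metric.isBounded_ball (x := (0 : ℂ)) (r := 1)).subset
    fun y hy => mem_ball_zero_iff.2 (hUD (subset_closure hy)).2
  have htsupport : tsupport (U.indicator ρ) ⊆ closure U :=
    closure_mono Set.support_indicator_subset
  have hlim := tendsto_integral_fourierChar_re_comp_mul hQ hQ' (hρ.integrable_indicator hU)
    (hUb.isCompact_closure.of_isClosed_subset (isClosed_tsupport _) htsupport)
    (htsupport.trans hUD)
  refine hlim.congr fun a => ?_
  rw [← integral_indicator hU]
  simp only [Set.indicator_mul_right]

theorem tendsto_setIntegral_torusCurve (hU : MeasurableSet U) (hUD : closure U ⊆ puncturedDisc)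
    (hθ : ContinuousOn θ puncturedDisc) (hchar : HasPolarCharacters θ)
    (μ : Measure (UnitAddTorus ι)) [IsProbabilityMeasure μ] [μ.IsAddLeftInvariant] {ρ : ℂ → ℝ}
    (hρ : IntegrableOn ρ U) (G : C(UnitAddTorus ι, ℝ)) :
    Tendsto (fun a => ∫ y in U, G (torusCurve θ (a * y)) * ρ y) (𝓝[≠] 0)
      (𝓝 ((∫ t, G t ∂μ) * ∫ y in U, ρ y)) := by
  have hmeas : ∀ᶠ a in 𝓝[≠] (0 : ℂ),
      AEMeasurable (fun y => torusCurve θ (a * y)) (volume.restrict U) := by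
    filter_upwards [puncturedDisc_mem_nhdsNE] with a ha
    exact (aestronglyMeasurable_comp_mul hU (subset_closure.trans hUD)
      (continuousOn_torusCurve hθ) ha).aemeasurable
  have hlim := tendsto_integral_comp_mul_of_mFourier hρ.ofReal μ hmeas (fun n hn => ?_)
    ⟨fun t => (G t : ℂ), by fun_prop⟩
  · simp only [ContinuousMap.coe_mk, ← RCLike.ofReal_eq_complex_ofReal, ← RCLike.ofReal_mul,
      integral_ofReal] at hlim
    exact (RCLike.continuous_re.tendsto _).comp hlim
  · obtain ⟨Q, hQ, hQ', hre⟩ := hchar n hn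
    refine (tendsto_setIntegral_fourierChar_re_comp_mul hU hUD hQ hQ' hρ.ofReal).congr fun a => ?_
    simp only [mFourier_torusCurve, hre]

instance : IsProbabilityMeasure (volume : Measure UnitAddCircle) := ⟨UnitAddCircle.measure_univ⟩

theorem exists_ball_closure_subset_puncturedDisc :
    ∃ c : ℂ, ∃ r > 0, closure (Metric.ball c r) ⊆ puncturedDisc := by
  refine ⟨1 / 2, 1 / 4, by norm_num, Metric.closure_ball_subset_closedBall.trans fun x hx => ?_⟩
  rw [mem_closedBall_iff_norm] at hx
  have h₁ := norm_sub_norm_le (1 / 2 : ℂ) x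
  have h₂ := norm_sub_norm_le x (1 / 2 : ℂ)
  rw [norm_sub_rev] at h₁
  norm_num at h₁ h₂ hx
  exact ⟨norm_pos_iff.1 (by linarith), by linarith⟩

theorem mapClusterPt_torusCurve (hθ : ContinuousOn θ puncturedDisc) (hchar : HasPolarCharacters θ)
    (t : UnitAddTorus ι) : MapClusterPt t (𝓝[≠] 0) (torusCurve θ) := by
  rw [mapClusterPt_iff_frequently]
  intro N hN havoid
  obtain ⟨ε, hε, hεN⟩ := Metric.mem_nhds_iff.1 hN
  -- the average of a bump function at `t` along the curve would tend to a positive limit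
  let G : C(UnitAddTorus ι, ℝ) := ⟨fun s => max 0 (ε - dist s t), by fun_prop⟩
  have hG {s : UnitAddTorus ι} (hs : s ∉ N) : G s = 0 :=
    max_eq_left (sub_nonpos.2 (not_lt.1 fun h => hs (hεN h)))
  have hGpos : 0 < ∫ s, G s :=
    G.continuous.integral_pos_of_hasCompactSupport_nonneg_nonzero
      (HasCompactSupport.of_compactSpace _) (fun s => le_max_left _ _) (x := t)
      (by simp [G, hε.ne', hε.le])
  obtain ⟨c, r, hr, hcr⟩ := exists_ball_closure_subset_puncturedDisc
  have hvol : 0 < ∫ _ in Metric.ball c r, (1 : ℝ) := by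
    rw [setIntegral_const, smul_eq_mul, mul_one]
    exact ENNReal.toReal_pos (Metric.measure_ball_pos volume c hr).ne' measure_ball_lt_top.ne
  have hlim := tendsto_setIntegral_torusCurve measurableSet_ball hcr hθ hchar volume
    (integrableOn_const measure_ball_lt_top.ne (C := (1 : ℝ))) G
  have hzero : ∀ᶠ a in 𝓝[≠] (0 : ℂ),
      ∫ y in Metric.ball c r, G (torusCurve θ (a * y)) * 1 = 0 := by
    filter_upwards [eventually_forall_mul_of_eventually_nhdsNE havoid] with a ha
    exact setIntegral_eq_zero_of_forall_eq_zero fun y hy =>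
      mul_eq_zero_of_left (hG (ha y (hcr (subset_closure hy)))) _
  exact (mul_pos hGpos hvol).ne' (tendsto_nhds_unique hlim (tendsto_const_nhds.congr'
    (hzero.mono fun a ha => ha.symm)))

end TorusCurves

section AsymptoticTorusCurve

variable {T ι : Type*} [AddCommGroup T] [TopologicalSpace T] [IsTopologicalAddGroup T] [Fintype ι]

/-- The curve `F` in `T` is asymptotic at `0` to the image under `Φ` of the curve covered by `θ`,
which has polar characters. For `T = E / Γ` this is the form in which an expansion of `f`
determines the behaviour of `π ∘ f`. -/
structure IsAsymptoticToTorusCurve (F : ℂ → T) (Φ : C(UnitAddTorus ι, T)) (θ : ℂ → ι → ℝ) :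
    Prop where
  continuousOn : ContinuousOn θ puncturedDisc
  hasPolarCharacters : HasPolarCharacters θ
  tendsto_sub : Tendsto (fun x => F x - Φ (torusCurve θ x)) (𝓝[≠] 0) (𝓝 0)

namespace IsAsymptoticToTorusCurve

variable {F : ℂ → T} {Φ : C(UnitAddTorus ι, T)} {θ : ℂ → ι → ℝ}
  (h : IsAsymptoticToTorusCurve F Φ θ)

include h

theorem setOf_mapClusterPt [T2Space T] : {t | MapClusterPt t (𝓝[≠] 0) F} = Set.range Φ := by
  ext p
  constructor
  · exact fun hp => mem_of_mapClusterPt_of_tendsto_sub (isCompact_range Φ.continuous).isClosed hp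
      h.tendsto_sub (Eventually.of_forall fun x => Set.mem_range_self _)
  · rintro ⟨t, rfl⟩
    exact mapClusterPt_of_tendsto_sub ((mapClusterPt_torusCurve h.continuousOn
      h.hasPolarCharacters t).continuousAt_comp Φ.continuous.continuousAt) h.tendsto_sub

theorem tendsto_setIntegral (hF : ContinuousOn F puncturedDisc) {U : Set ℂ} (hU : MeasurableSet U)
    (hUD : closure U ⊆ puncturedDisc) (μ : Measure (UnitAddTorus ι)) [IsProbabilityMeasure μ]
    [μ.IsAddLeftInvariant] {ρ : ℂ → ℝ} (hρ : IntegrableOn ρ U) (g : T →ᵇ ℝ) :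
    Tendsto (fun a => ∫ y in U, g (F (a * y)) * ρ y) (𝓝[≠] 0)
      (𝓝 ((∫ t, g (Φ t) ∂μ) * ∫ y in U, ρ y)) := by
  let G : C(UnitAddTorus ι, ℝ) := g.toContinuousMap.comp Φ
  exact tendsto_setIntegral_comp_mul_of_tendsto_sub hU (subset_closure.trans hUD) hρ
    (g.continuous.comp_continuousOn hF)
    (G.continuous.comp_continuousOn (continuousOn_torusCurve h.continuousOn))
    (fun x => g.norm_coe_le_norm _)
    (tendsto_comp_sub_of_tendsto_sub (isCompact_range Φ.continuous)
      (fun x => Set.mem_range_self _) h.tendsto_sub g.continuous)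
    (tendsto_setIntegral_torusCurve hU hUD h.continuousOn h.hasPolarCharacters μ hρ G)

end IsAsymptoticToTorusCurve

end AsymptoticTorusCurve

section Poles

theorem tendsto_pow_mul_inv_pow {m n : ℕ} (h : m < n) :
    Tendsto (fun x : ℂ => x ^ n * (x ^ m)⁻¹) (𝓝[≠] 0) (𝓝 0) := by
  have hlim : Tendsto (fun x : ℂ => x ^ (n - m)) (𝓝[≠] 0) (𝓝 0) :=
    ((continuous_pow (n - m)).tendsto' 0 0 (zero_pow (Nat.sub_ne_zero_of_lt h))).mono_left
      nhdsWithin_le_nhds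
  refine hlim.congr' ?_
  filter_upwards [self_mem_nhdsWithin] with x hx using pow_sub₀ x hx h.le

theorem update_eventuallyEq_of_ne {V : Type*} {f : ℂ → V} {b : V} {x : ℂ} (hx : x ≠ 0) :
    Function.update f 0 b =ᶠ[𝓝 x] f := by
  filter_upwards [eventually_ne_nhds hx] with y hy using Function.update_of_ne hy _ _

theorem analyticAt_update_of_tendsto {V : Type*} [NormedAddCommGroup V] [NormedSpace ℂ V]
    [CompleteSpace V] {f : ℂ → V} (hf : DifferentiableOn ℂ f puncturedDisc) {b : V}
    (hlim : Tendsto f (𝓝[≠] 0) (𝓝 b)) : AnalyticAt ℂ (Function.update f 0 b) 0 := by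
  refine Complex.analyticAt_of_differentiable_on_punctured_nhds_of_continuousAt ?_
    (continuousAt_update_same.2 hlim)
  filter_upwards [puncturedDisc_mem_nhdsNE] with x hx
  exact (hf.differentiableAt (isOpen_puncturedDisc.mem_nhds hx)).congr_of_eventuallyEq
    (update_eventuallyEq_of_ne hx.1)

theorem tendsto_pow_smul_deriv {V : Type*} [NormedAddCommGroup V] [NormedSpace ℂ V]
    [CompleteSpace V] {f : ℂ → V} (hf : DifferentiableOn ℂ f puncturedDisc) {D : ℕ} {b : V}
    (hlim : Tendsto (fun x => x ^ D • f x) (𝓝[≠] 0) (𝓝 b)) :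
    Tendsto (fun x => x ^ (D + 1) • deriv f x) (𝓝[≠] 0) (𝓝 (-((D : ℂ) • b))) := by
  have hf' {x : ℂ} (hx : x ∈ puncturedDisc) : DifferentiableAt ℂ f x :=
    hf.differentiableAt (isOpen_puncturedDisc.mem_nhds hx)
  have hGan := analyticAt_update_of_tendsto ((differentiable_pow D).differentiableOn.smul hf) hlim
  set G := Function.update (fun x => x ^ D • f x) 0 b
  have hG' : Tendsto (fun x => x • deriv G x) (𝓝[≠] 0) (𝓝 0) :=
    ((continuousAt_id.smul hGan.deriv.continuousAt).tendsto.mono_left nhdsWithin_le_nhds).trans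
      (by simp)
  refine ((hG'.sub (hlim.const_smul (D : ℂ))).congr' ?_).trans (by rw [zero_sub])
  filter_upwards [puncturedDisc_mem_nhdsNE] with x hx
  rw [(update_eventuallyEq_of_ne hx.1).deriv_eq, deriv_fun_smul (by fun_prop) (hf' hx),
    deriv_pow_field]
  rcases D with _ | D
  · simp
  · simp only [smul_add, smul_smul, Nat.add_sub_cancel, pow_succ]
    rw [Nat.cast_succ]
    module

theorem tendsto_mul_deriv_cobounded {Q : ℂ → ℂ} (hQ : DifferentiableOn ℂ Q puncturedDisc) {D : ℕ}
    (hD : D ≠ 0) {b : ℂ} (hb : b ≠ 0) (hlim : Tendsto (fun x => x ^ D * Q x) (𝓝[≠] 0) (𝓝 b)) :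
    Tendsto (fun x => x * deriv Q x) (𝓝[≠] 0) (Bornology.cobounded ℂ) := by
  have hc : -((D : ℂ) * b) ≠ 0 := neg_ne_zero.2 (mul_ne_zero (Nat.cast_ne_zero.2 hD) hb)
  have hderiv : Tendsto (fun x => x ^ (D + 1) * deriv Q x) (𝓝[≠] 0) (𝓝 (-((D : ℂ) * b))) :=
    tendsto_pow_smul_deriv hQ hlim
  have hinv : Tendsto (fun x => (x * deriv Q x)⁻¹) (𝓝[≠] 0) (𝓝 0) := by
    have hpow := tendsto_pow_mul_inv_pow (Nat.pos_of_ne_zero hD)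
    refine ((hpow.mul (hderiv.inv₀ hc)).congr' ?_).trans (by rw [zero_mul])
    filter_upwards [self_mem_nhdsWithin] with x hx
    rw [pow_zero, inv_one, mul_one, pow_succ, mul_assoc, mul_inv,
      mul_inv_cancel_left₀ (pow_ne_zero D hx)]
  refine (tendsto_inv₀_nhdsNE_zero.comp (tendsto_nhdsWithin_iff.2 ⟨hinv, ?_⟩)).congr
    fun x => inv_inv _
  filter_upwards [hderiv.eventually_ne hc] with x hx
  exact inv_ne_zero fun h => hx (by rw [pow_succ, mul_assoc, h, mul_zero])

end Poles

namespace IsExpansion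

variable {E : Type*} [NormedAddCommGroup E] [InnerProductSpace ℂ E] {f : ℂ → E} {k : ℕ}
  {d : ℕ → ℕ} {v : ℕ → E} (he : IsExpansion f k d v)

include he

theorem degree_pos {j : ℕ} (hj : j ∈ Finset.Icc 1 k) : 0 < d j := by
  obtain ⟨h1, hk⟩ := Finset.mem_Icc.1 hj
  exact he.last ▸ he.strictAnti ⟨h1, by lia⟩ ⟨by lia, le_rfl⟩ (by lia)

theorem degree_lt {i j : ℕ} (hi : i ∈ Finset.Icc 1 k) (hj : j ∈ Finset.Icc 1 k) (hij : i < j) :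
    d j < d i := by
  rw [Finset.mem_Icc] at hi hj
  exact he.strictAnti ⟨hi.1, by lia⟩ ⟨hj.1, by lia⟩ hij

theorem tendsto_pow_smul {V : Type*} [NormedAddCommGroup V] [NormedSpace ℂ V] (L : E →L[ℂ] V)
    {i : ℕ} (hi : i ∈ Finset.Icc 1 k) (hL : ∀ j ∈ Finset.Icc 1 k, j < i → L (v j) = 0) :
    Tendsto (fun x => x ^ d i • L (f x - v (k + 1))) (𝓝[≠] 0) (𝓝 (L (v i))) := by
  obtain ⟨h, r, hh, hr, hf⟩ := he.expansion
  have hid : Tendsto (fun x : ℂ => x) (𝓝[≠] 0) (𝓝 0) := nhdsWithin_le_nhds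
  have hcoeff {j : ℕ} (hj : j ∈ Finset.Icc 1 k) : Tendsto (fun x => 1 + h j x) (𝓝[≠] 0) (𝓝 1) :=
    (((hh j hj).trans_tendsto hid).const_add 1).trans (by rw [add_zero])
  have hterm (j : ℕ) (hj : j ∈ Finset.Icc 1 k) :
      Tendsto (fun x => ((1 + h j x) * (x ^ d i * (x ^ d j)⁻¹)) • L (v j)) (𝓝[≠] 0)
        (𝓝 (if j = i then L (v i) else 0)) := by
    rcases lt_trichotomy j i with hlt | rfl | hgt
    · simp [hL j hj hlt, hlt.ne]
    · refine (((hcoeff hj).smul_const (L (v j))).congr' ?_).trans (by simp)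
      filter_upwards [self_mem_nhdsWithin] with x hx
      rw [mul_inv_cancel₀ (pow_ne_zero _ hx), mul_one]
    · exact (((hcoeff hj).mul (tendsto_pow_mul_inv_pow (he.degree_lt hi hj hgt))).smul_const
        (L (v j))).trans (by simp [hgt.ne'])
  have hrem : Tendsto (fun x => x ^ d i • L (r x)) (𝓝[≠] 0) (𝓝 0) :=
    ((hid.pow (d i)).smul ((L.continuous.tendsto 0).comp (hr.trans_tendsto hid))).trans (by simp)
  have hsum := (tendsto_finsetSum _ hterm).add hrem
  rw [Finset.sum_ite_eq' (Finset.Icc 1 k) i, if_pos hi, add_zero] at hsum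
  refine hsum.congr' ?_
  filter_upwards [hf] with x hx
  rw [hx, add_right_comm, add_sub_cancel_right]
  simp only [map_add, map_sum, map_smul, smul_add, Finset.smul_sum, smul_smul, mul_left_comm]

theorem tendsto_pow_smul_self : Tendsto (fun x => x ^ d 1 • f x) (𝓝[≠] 0) (𝓝 (v 1)) := by
  have hk : 1 ∈ Finset.Icc 1 k := Finset.mem_Icc.2 ⟨le_rfl, he.one_le⟩
  have hlim := he.tendsto_pow_smul (ContinuousLinearMap.id ℂ E) hk
    fun j hj hj1 => absurd (Finset.mem_Icc.1 hj).1 hj1.not_ge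
  have hconst : Tendsto (fun x : ℂ => x ^ d 1 • v (k + 1)) (𝓝[≠] 0) (𝓝 0) :=
    (Continuous.tendsto' (by fun_prop) _ _ (by simp [(he.degree_pos hk).ne'])).mono_left
      nhdsWithin_le_nhds
  simpa [smul_sub] using hlim.add hconst

theorem exists_tendsto_zero_sub_mem_flag : ∃ r : ℂ → E, Tendsto r (𝓝[≠] 0) (𝓝 0) ∧
    ∀ᶠ x in 𝓝[≠] 0, f x - v (k + 1) - r x ∈ flag v k := by
  obtain ⟨h, r, -, hr, hf⟩ := he.expansion
  refine ⟨r, hr.trans_tendsto nhdsWithin_le_nhds, ?_⟩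
  filter_upwards [hf] with x hx
  rw [hx, sub_sub, add_assoc, add_sub_cancel_right]
  exact Submodule.sum_mem _ fun j hj => Submodule.smul_mem _ _
    (Submodule.subset_span ⟨j, by simpa using hj, rfl⟩)

theorem exists_differentiableOn_re_eq (hf : DifferentiableOn ℂ f puncturedDisc) (ξ : E →L[ℝ] ℝ)
    (hξ : ∃ u ∈ flag v k, ξ u ≠ 0) :
    ∃ Q : ℂ → ℂ, DifferentiableOn ℂ Q puncturedDisc ∧
      Tendsto (fun x => x * deriv Q x) (𝓝[≠] 0) (Bornology.cobounded ℂ) ∧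
      ∀ x, (Q x).re = ξ (f x - v (k + 1)) := by
  let η : E →L[ℂ] ℂ := StrongDual.extendRCLike (𝕜 := ℂ) ξ
  have hη (x : E) : (η x).re = ξ x := StrongDual.re_extendRCLike_apply (𝕜 := ℂ) ξ x
  -- the first `v j` on which `η` does not vanish gives the polar part of `η ∘ f`
  obtain ⟨j, ⟨hj, hηj⟩, hmin⟩ := exists_minimal_of_wellFoundedLT
    (fun j => j ∈ Finset.Icc 1 k ∧ η (v j) ≠ 0) (by
      by_contra! hzero
      obtain ⟨u, hu, hu0⟩ := hξ
      have hker : flag v k ≤ LinearMap.ker (η : E →ₗ[ℂ] ℂ) :=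
        Submodule.span_le.2 (by rintro _ ⟨j, hj, rfl⟩; exact hzero j (by simpa using hj))
      exact hu0 (by rw [← hη, show η u = 0 from hker hu, Complex.zero_re]))
  have hQ : DifferentiableOn ℂ (fun x => η (f x - v (k + 1))) puncturedDisc :=
    η.differentiable.comp_differentiableOn (hf.sub_const _)
  refine ⟨_, hQ, tendsto_mul_deriv_cobounded hQ (he.degree_pos hj).ne' hηj
    (he.tendsto_pow_smul η hj fun i hi hij => ?_), fun x => hη _⟩
  by_contra h
  exact hij.not_ge (hmin ⟨hi, h⟩ hij.le)

end IsExpansion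

section TorusParametrization

variable {E : Type*} [NormedAddCommGroup E] [InnerProductSpace ℂ E] {Γ : AddSubgroup E}
  {ι : Type*} [Fintype ι]

/-- The parametrization of the translate through `c` of the subtorus spanned by a rational
frame. -/
noncomputable def RationalFrame.torusMap {F : Submodule ℝ E} (R : RationalFrame Γ F ι) (c : E) :
    C(UnitAddTorus ι, E ⧸ Γ) :=
  ⟨fun t => proj Γ c + torusHom Γ R.vec_mem t, continuous_const.add (continuous_torusHom Γ _)⟩

theorem RationalFrame.range_torusMap {F : Submodule ℝ E} (R : RationalFrame Γ F ι) (c : E) :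
    Set.range (R.torusMap c) =
      proj Γ '' (AffineSubspace.mk' c (Submodule.span ℝ (Set.range R.vec)) : Set E) :=
  range_coe_add_torusHom Γ R.vec_mem c

theorem RationalFrame.isTranslatedSubtorus {F : Submodule ℝ E} (R : RationalFrame Γ F ι) (c : E) :
    IsTranslatedSubtorus Γ (Set.range (R.torusMap c)) := by
  refine ⟨c, _, le_antisymm (Submodule.span_mono ?_) (Submodule.span_le.2 fun _ h => h.2),
    R.range_torusMap c⟩
  exact Set.range_subset_iff.2 fun i => ⟨R.vec_mem i, Submodule.subset_span ⟨i, rfl⟩⟩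

variable {f : ℂ → E} {k : ℕ} {d : ℕ → ℕ} {v : ℕ → E}

theorem coe_affineV (v : ℕ → E) (k : ℕ) : (affineV v k : Set E) =
    AffineSubspace.mk' (v (k + 1)) ((flag v k).restrictScalars ℝ) := by
  ext x
  simp [affineV, AffineSubspace.mem_mk']

theorem flag_le_realSpan_of_isTranslatedSubtorus [Countable Γ]
    (h : IsTranslatedSubtorus Γ (closure (proj Γ '' (affineV v k : Set E)))) :
    (flag v k).restrictScalars ℝ ≤ realSpan Γ := by
  obtain ⟨c, W, hW, hS⟩ := h
  rw [coe_affineV] at hS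
  refine (le_of_image_coe_subset Γ (subset_closure.trans hS.subset)).trans ?_
  rw [hW]
  exact Submodule.span_mono Set.inter_subset_left

theorem exists_rationalFrame_flag (h : (flag v k).restrictScalars ℝ ≤ realSpan Γ) :
    ∃ m, Nonempty (RationalFrame Γ ((flag v k).restrictScalars ℝ) (Fin m)) := by
  have : FiniteDimensional ℂ (flag v k) :=
    FiniteDimensional.span_of_finite ℂ ((Set.finite_Icc 1 k).image v)
  have : FiniteDimensional ℝ ((flag v k).restrictScalars ℝ) :=
    FiniteDimensional.complexToReal (flag v k)
  exact exists_rationalFrame h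

namespace IsExpansion

variable (he : IsExpansion f k d v)

include he

theorem exists_tendsto_sub_proj_zero :
    ∃ w : ℂ → E, (∀ᶠ x in 𝓝[≠] 0, w x ∈ affineV v k) ∧
      Tendsto (fun x => proj Γ (f x) - proj Γ (w x)) (𝓝[≠] 0) (𝓝 0) := by
  obtain ⟨r, hr, hfr⟩ := he.exists_tendsto_zero_sub_mem_flag
  refine ⟨fun x => f x - r x, ?_, ?_⟩
  · filter_upwards [hfr] with x hx
    rwa [affineV, AffineSubspace.mem_mk', vsub_eq_sub, sub_right_comm]
  · refine ((QuotientAddGroup.continuous_mk.tendsto' (0 : E) (0 : E ⧸ Γ) rfl).comp hr).congr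
      fun x => ?_
    simp only [Function.comp_apply, proj, ← QuotientAddGroup.mk_sub, sub_sub_cancel]

theorem clusterSet_subset_closure : clusterSet Γ f ⊆ closure (proj Γ '' (affineV v k : Set E)) := by
  intro t ht
  obtain ⟨w, hw, hfw⟩ := he.exists_tendsto_sub_proj_zero (Γ := Γ)
  exact mem_of_mapClusterPt_of_tendsto_sub isClosed_closure ht hfw
    (hw.mono fun x hx => subset_closure (Set.mem_image_of_mem _ hx))

variable (hf : DifferentiableOn ℂ f puncturedDisc)
  (R : RationalFrame Γ ((flag v k).restrictScalars ℝ) ι)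

include hf

theorem isAsymptoticToTorusCurve :
    IsAsymptoticToTorusCurve (fun x => proj Γ (f x)) (R.torusMap (v (k + 1)))
      fun x i => R.coord i (f x - v (k + 1)) where
  continuousOn := continuousOn_pi.2 fun i =>
    (R.coord i).continuous.comp_continuousOn (hf.continuousOn.sub continuousOn_const)
  hasPolarCharacters n hn := by
    obtain ⟨u, hu, hu0⟩ := R.exists_ne_zero n hn
    obtain ⟨Q, hQ, hQ', hre⟩ := he.exists_differentiableOn_re_eq hf
      (∑ i, (n i : ℝ) • R.coord i) ⟨u, hu, by simpa using hu0⟩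
    exact ⟨Q, hQ, hQ', fun x => by simpa using hre x⟩
  tendsto_sub := by
    obtain ⟨r, hr, hfr⟩ := he.exists_tendsto_zero_sub_mem_flag
    -- the projection along the span of the frame
    let P : E →L[ℝ] E := ContinuousLinearMap.id ℝ E - ∑ i, (R.coord i).smulRight (R.vec i)
    have hP (u : E) : P u = u - ∑ i, R.coord i u • R.vec i := by
      simp [P]
    have hlim : Tendsto (fun x => proj Γ (P (r x))) (𝓝[≠] 0) (𝓝 0) :=
      ((QuotientAddGroup.continuous_mk.comp P.continuous).tendsto' 0 (0 : E ⧸ Γ)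
        (by simp)).comp hr
    refine hlim.congr' ?_
    filter_upwards [hfr] with x hx
    have hPr : P (f x - v (k + 1)) = P (r x) := by
      rw [← sub_eq_zero, ← map_sub, hP, R.sum_coord_smul_vec (R.le_span hx), sub_self]
    calc proj Γ (P (r x))
        = proj Γ (f x - (v (k + 1) + ∑ i, R.coord i (f x - v (k + 1)) • R.vec i)) := by
          rw [← hPr, hP, sub_sub]
      _ = proj Γ (f x) - (proj Γ (v (k + 1)) +
            torusHom Γ R.vec_mem fun i => (R.coord i (f x - v (k + 1)) : UnitAddCircle)) := by
          rw [torusHom_coe]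
          rfl

theorem clusterSet_eq_range [IsClosed (Γ : Set E)] :
    clusterSet Γ f = Set.range (R.torusMap (v (k + 1))) :=
  (he.isAsymptoticToTorusCurve hf R).setOf_mapClusterPt

theorem closure_image_affineV [IsClosed (Γ : Set E)] :
    closure (proj Γ '' (affineV v k : Set E)) = Set.range (R.torusMap (v (k + 1))) := by
  refine (closure_minimal ?_ (isCompact_range (R.torusMap _).continuous).isClosed).antisymm
    (he.clusterSet_eq_range hf R ▸ he.clusterSet_subset_closure)
  rw [coe_affineV, R.range_torusMap]
  exact Set.image_mono fun x hx => R.le_span hx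

end IsExpansion

end TorusParametrization

section LaurentExpansion

variable {V : Type*} [NormedAddCommGroup V] [NormedSpace ℂ V]

theorem HasPolynomialGrowth.exists_tendsto_pow_smul_zero {E : Type*} [NormedAddCommGroup E]
    [InnerProductSpace ℂ E] {f : ℂ → E} (hgrowth : HasPolynomialGrowth f) :
    ∃ D : ℕ, Tendsto (fun x => x ^ D • f x) (𝓝[≠] 0) (𝓝 0) := by
  obtain ⟨N, hN⟩ := hgrowth
  refine ⟨N.toNat + 1, ((isBigO_refl (fun x : ℂ => x ^ (N.toNat + 1)) _).smul hN).trans_tendsto ?_⟩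
  have hpow : Tendsto (fun x : ℂ => x ^ (N.toNat + 1 - N).toNat) (𝓝[≠] 0) (𝓝 0) :=
    ((continuous_pow _).tendsto' 0 0 (zero_pow (by lia))).mono_left nhdsWithin_le_nhds
  refine hpow.congr' ?_
  filter_upwards [self_mem_nhdsWithin] with x hx
  rw [smul_eq_mul, ← zpow_natCast, ← zpow_natCast, ← zpow_add₀ hx]
  congr 1
  lia

theorem exists_isBigO_sub_sum_inv_pow_smul [CompleteSpace V] {f : ℂ → V}
    (hf : DifferentiableOn ℂ f puncturedDisc) {D : ℕ}
    (hlim : Tendsto (fun x => x ^ D • f x) (𝓝[≠] 0) (𝓝 0)) :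
    ∃ c : ℕ → V, (fun x => f x - ∑ m ∈ Finset.range (D + 1), (x ^ m)⁻¹ • c m) =O[𝓝[≠] 0]
      fun x => x := by
  obtain ⟨p, hp⟩ :=
    analyticAt_update_of_tendsto ((differentiable_pow D).differentiableOn.smul hf) hlim
  refine ⟨fun m => p.coeff (D - m), ?_⟩
  have htaylor := (hp.isBigO_sub_partialSum_pow (D + 1)).mono
    (nhdsWithin_le_nhds (s := {0}ᶜ))
  simp only [← norm_pow, isBigO_norm_right, zero_add] at htaylor
  refine ((isBigO_refl (fun x : ℂ => (x ^ D)⁻¹) _).smul htaylor).congr' ?_ ?_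
  · filter_upwards [self_mem_nhdsWithin] with x hx
    rw [Function.update_of_ne hx, smul_sub, Pi.smul_apply', inv_smul_smul₀ (pow_ne_zero D hx),
      ← Finset.sum_range_reflect]
    simp only [FormalMultilinearSeries.partialSum, Finset.smul_sum,
      FormalMultilinearSeries.apply_eq_pow_smul_coeff, smul_smul]
    refine congrArg (f x - ·) (Finset.sum_congr rfl fun m hm => ?_)
    have hmD := Nat.le_of_lt_succ (Finset.mem_range.1 hm)
    rw [Nat.add_sub_cancel, Nat.sub_sub_self hmD, pow_sub₀ x hx hmD, mul_inv, inv_inv]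
  · filter_upwards [self_mem_nhdsWithin] with x hx
    rw [smul_eq_mul, pow_succ, inv_mul_cancel_left₀ (pow_ne_zero D hx)]

theorem isBigO_pow_self {n : ℕ} (hn : n ≠ 0) :
    (fun x : ℂ => x ^ n) =O[𝓝[≠] 0] fun x => x := by
  obtain ⟨m, rfl⟩ := Nat.exists_eq_succ_of_ne_zero hn
  have hm : (fun x : ℂ => x ^ m) =O[𝓝[≠] 0] fun _ => (1 : ℂ) :=
    (((continuous_pow m).tendsto (0 : ℂ)).isBigO_one ℂ).mono nhdsWithin_le_nhds
  simpa [pow_succ] using hm.mul (isBigO_refl (fun x : ℂ => x) _)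

theorem exists_linearIndepOn_sum_inv_pow_smul (c : ℕ → V) (A : Finset ℕ) :
    ∃ S ⊆ A, LinearIndepOn ℂ c (S : Set ℕ) ∧ ∃ h : ℕ → ℂ → ℂ,
      (∀ s ∈ S, h s =O[𝓝[≠] 0] fun x => x) ∧
      ∀ x ≠ 0, ∑ m ∈ A, (x ^ m)⁻¹ • c m = ∑ s ∈ S, ((1 + h s x) * (x ^ s)⁻¹) • c s := by
  induction A using Finset.induction_on_min with
  | empty => exact ⟨∅, by simp⟩
  | insert a A ha ih =>
    obtain ⟨S, hSA, hS, h, hh, hsum⟩ := ih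
    have haA : a ∉ A := fun hmem => (ha a hmem).false
    simp only [Finset.sum_insert haA]
    by_cases hca : c a ∈ Submodule.span ℂ (c '' S)
    · obtain ⟨β, hβS, hβ⟩ := (Finsupp.mem_span_image_iff_linearCombination ℂ).1 hca
      rw [Finsupp.linearCombination_apply_of_mem_supported ℂ hβS] at hβ
      refine ⟨S, hSA.trans (Finset.subset_insert a A), hS, fun s x => h s x + β s * x ^ (s - a),
        fun s hs => ?_, fun x hx => ?_⟩
      · exact (hh s hs).add
          ((isBigO_pow_self (Nat.sub_pos_of_lt (ha s (hSA hs))).ne').const_mul_left (β s))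
      · rw [hsum x hx, ← hβ, Finset.smul_sum, ← Finset.sum_add_distrib]
        refine Finset.sum_congr rfl fun s hs => ?_
        simp only [smul_smul, ← add_smul, pow_sub₀ x hx (ha s (hSA hs)).le]
        congr 1
        field_simp
        ring
    · have haS : a ∉ S := fun hmem => haA (hSA hmem)
      refine ⟨insert a S, Finset.insert_subset_insert a hSA, ?_, Function.update h a 0,
        fun s hs => ?_, fun x hx => ?_⟩
      · rw [Finset.coe_insert]
        exact hS.insert hca
      · rcases Finset.mem_insert.1 hs with rfl | hs
        · rw [Function.update_self]
          exact isBigO_zero _ _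
        · rw [Function.update_of_ne (ne_of_mem_of_not_mem hs haS)]
          exact hh s hs
      · rw [Finset.sum_insert haS, hsum x hx, Function.update_self, Pi.zero_apply, add_zero,
          one_mul]
        congr 1
        refine Finset.sum_congr rfl fun s hs => ?_
        rw [Function.update_of_ne (ne_of_mem_of_not_mem hs haS)]

end LaurentExpansion

section Enumeration

theorem exists_strictAntiOn_image_eq {S : Finset ℕ} (hS : 0 ∉ S) :
    ∃ d : ℕ → ℕ, StrictAntiOn d (Set.Icc 1 (S.card + 1)) ∧ d (S.card + 1) = 0 ∧
      (Finset.Icc 1 S.card).image d = S := by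
  have hfin := (insert 0 S).finite_toSet
  have hcard : hfin.toFinset.card = S.card + 1 := by simp [hS]
  let d (j : ℕ) : ℕ := Nat.nth (· ∈ insert 0 S) (S.card + 1 - j)
  have hd : StrictAntiOn d (Set.Icc 1 (S.card + 1)) := fun i hi j hj hij => by
    rw [Set.mem_Icc] at hi hj
    refine Nat.nth_strictMonoOn hfin (Set.mem_Iio.2 ?_) (Set.mem_Iio.2 ?_) ?_
    · rw [hcard]
      lia
    · rw [hcard]
      lia
    · lia
  have hlast : d (S.card + 1) = 0 := by
    simp only [d, Nat.sub_self]
    exact Nat.nth_zero_of_zero (Finset.mem_insert_self 0 S)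
  refine ⟨d, hd, hlast,
    Finset.eq_of_subset_of_card_le (Finset.image_subset_iff.2 fun j hj => ?_) ?_⟩
  · rw [Finset.mem_Icc] at hj
    have hmem : d j ∈ insert 0 S := Nat.nth_mem _ fun hfin' => by
      rw [show hfin'.toFinset = hfin.toFinset from rfl, hcard]
      lia
    have hpos : d (S.card + 1) < d j := hd ⟨hj.1, by lia⟩ ⟨by lia, le_rfl⟩ (by lia)
    exact Finset.mem_of_mem_insert_of_ne hmem (by lia)
  · rw [Finset.card_image_of_injOn, Nat.card_Icc, Nat.add_sub_cancel]
    rw [Finset.coe_Icc]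
    exact hd.injOn.mono (Set.Icc_subset_Icc_right (Nat.le_succ _))

end Enumeration

section Expansion

variable {E : Type*} [NormedAddCommGroup E] [InnerProductSpace ℂ E] {f : ℂ → E}

theorem exists_isExpansion_of_eventually_eq_sum {S : Finset ℕ} (hS0 : 0 ∉ S) (hne : S.Nonempty)
    {c : ℕ → E} (hc : LinearIndepOn ℂ c (S : Set ℕ)) {h : ℕ → ℂ → ℂ} {r : ℂ → E}
    (hh : ∀ s ∈ S, h s =O[𝓝[≠] 0] fun x => x) (hr : r =O[𝓝[≠] 0] fun x => x)
    (hf : ∀ᶠ x in 𝓝[≠] 0, f x = ∑ s ∈ S, ((1 + h s x) * (x ^ s)⁻¹) • c s + c 0 + r x) :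
    ∃ (k : ℕ) (d : ℕ → ℕ) (v : ℕ → E), IsExpansion f k d v := by
  obtain ⟨d, hd, hlast, hdS⟩ := exists_strictAntiOn_image_eq hS0
  have hinj : Set.InjOn d (Finset.Icc 1 S.card) := by
    rw [Finset.coe_Icc]
    exact hd.injOn.mono (Set.Icc_subset_Icc_right (Nat.le_succ _))
  refine ⟨S.card, d, c ∘ d, hne.card_pos, hd, hlast, ?_, fun j => h (d j), r,
    fun j hj => hh _ (hdS ▸ Finset.mem_image_of_mem d hj), hr, ?_⟩
  · rw [← Finset.coe_Icc]
    refine LinearIndepOn.comp_of_image ?_ hinj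
    rwa [← Finset.coe_image, hdS]
  · filter_upwards [hf] with x hx
    simp only [Function.comp_apply, hlast]
    rw [hx, ← Finset.sum_image (f := fun s => ((1 + h s x) * (x ^ s)⁻¹) • c s) hinj, hdS]

theorem exists_isExpansion_of_isBigO {c : ℕ → E} {D : ℕ}
    (hc : (fun x => f x - ∑ m ∈ Finset.range (D + 1), (x ^ m)⁻¹ • c m) =O[𝓝[≠] 0] fun x => x)
    (hlim : ¬ Tendsto f (𝓝[≠] 0) (𝓝 (c 0))) :
    ∃ (k : ℕ) (d : ℕ → ℕ) (v : ℕ → E), IsExpansion f k d v := by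
  obtain ⟨S, hSD, hS, h, hh, hsum⟩ :=
    exists_linearIndepOn_sum_inv_pow_smul c (Finset.Ico 1 (D + 1))
  set r := fun x => f x - ∑ m ∈ Finset.range (D + 1), (x ^ m)⁻¹ • c m with hr
  have hfr : ∀ᶠ x in 𝓝[≠] 0, f x = ∑ s ∈ S, ((1 + h s x) * (x ^ s)⁻¹) • c s + c 0 + r x := by
    filter_upwards [self_mem_nhdsWithin] with x hx
    simp only [hr]
    rw [Finset.range_eq_Ico, Finset.sum_eq_sum_Ico_succ_bot (Nat.succ_pos D), pow_zero, inv_one,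
      one_smul, zero_add, hsum x hx]
    abel
  have hne : S.Nonempty := by
    rw [Finset.nonempty_iff_ne_empty]
    rintro rfl
    refine hlim ?_
    have hcr := (hc.trans_tendsto nhdsWithin_le_nhds).const_add (c 0)
    rw [add_zero] at hcr
    refine hcr.congr' ?_
    filter_upwards [hfr] with x hx using by rw [hx, Finset.sum_empty, zero_add]
  exact exists_isExpansion_of_eventually_eq_sum
    (fun h0 => absurd (Finset.mem_Ico.1 (hSD h0)).1 (by simp)) hne hS hh hc hfr

theorem isBounded_image_closedPuncturedDisc_of_tendsto {X : Type*} [PseudoMetricSpace X]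
    {f : ℂ → X} (hf : ContinuousOn f closedPuncturedDisc) {b : X}
    (hlim : Tendsto f (𝓝[≠] 0) (𝓝 b)) : Bornology.IsBounded (f '' closedPuncturedDisc) := by
  have hcont : ContinuousOn (Function.update f 0 b) (Metric.closedBall 0 1) :=
    continuousOn_update_iff.2 ⟨hf.mono fun x hx => ⟨hx.2, mem_closedBall_zero_iff.1 hx.1⟩,
      fun _ => hlim.mono_left (nhdsWithin_mono 0 fun x hx => hx.2)⟩
  refine ((isCompact_closedBall 0 1).image_of_continuousOn hcont).isBounded.subset ?_
  rintro _ ⟨x, hx, rfl⟩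
  exact ⟨x, mem_closedBall_zero_iff.2 hx.2, Function.update_of_ne hx.1 _ _⟩

theorem exists_isExpansion [CompleteSpace E] (hcont : ContinuousOn f closedPuncturedDisc)
    (hf : DifferentiableOn ℂ f puncturedDisc) (hgrowth : HasPolynomialGrowth f)
    (hunb : ¬ Bornology.IsBounded (f '' closedPuncturedDisc)) :
    ∃ (k : ℕ) (d : ℕ → ℕ) (v : ℕ → E), IsExpansion f k d v := by
  obtain ⟨D, hD⟩ := hgrowth.exists_tendsto_pow_smul_zero
  obtain ⟨c, hc⟩ := exists_isBigO_sub_sum_inv_pow_smul hf hD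
  exact exists_isExpansion_of_isBigO hc fun hlim =>
    hunb (isBounded_image_closedPuncturedDisc_of_tendsto hcont hlim)

end Expansion

section Area

variable {E : Type*} [NormedAddCommGroup E]

section PullbackDensity

variable [InnerProductSpace ℂ E] {f : ℂ → E}

theorem pullbackDensity_eq {x : ℂ} (hf : DifferentiableAt ℂ f x) :
    pullbackDensity f x = 2 * ‖deriv f x‖ ^ 2 := by
  have hderiv : fderiv ℝ f x = (fderiv ℂ f x).restrictScalars ℝ := hf.fderiv_restrictScalars ℝ
  have hone : fderiv ℝ f x 1 = deriv f x := by
    rw [hderiv]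
    exact fderiv_apply_one_eq_deriv
  have hI : fderiv ℝ f x Complex.I = Complex.I • deriv f x := by
    rw [hderiv]
    exact fderiv_eq_smul_deriv Complex.I
  rw [pullbackDensity, kahlerForm, hone, hI, inner_smul_right, Complex.I_mul_im,
    ← RCLike.re_eq_complex_re, inner_self_eq_norm_sq]

theorem integral_areaMeasure [CompleteSpace E] [MeasurableSpace E] [BorelSpace E] {W : Set ℂ}
    (hW : IsOpen W) (hf : DifferentiableOn ℂ f W) {φ : E → ℝ}
    (hφ : AEStronglyMeasurable φ (areaMeasure f W)) :
    ∫ z, φ z ∂areaMeasure f W = ∫ x in W, φ (f x) * (2 * ‖deriv f x‖ ^ 2) := by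
  have hdensity {x : ℂ} (hx : x ∈ W) : pullbackDensity f x = 2 * ‖deriv f x‖ ^ 2 :=
    pullbackDensity_eq (hf.differentiableAt (hW.mem_nhds hx))
  have hmeas : AEMeasurable (pullbackDensity f) (volume.restrict W) := by
    have hcont : ContinuousOn (fun x => 2 * ‖deriv f x‖ ^ 2) W :=
      continuousOn_const.mul ((hf.deriv hW).continuousOn.norm.pow 2)
    refine (hcont.aemeasurable hW.measurableSet).congr ?_
    filter_upwards [ae_restrict_mem hW.measurableSet] with x hx using (hdensity hx).symm
  have hfmeas := (hf.continuousOn.aemeasurable (μ := volume) hW.measurableSet).mono_ac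
    (withDensity_absolutelyContinuous _ fun x => ENNReal.ofReal (pullbackDensity f x))
  rw [areaMeasure, integral_map hfmeas hφ, integral_withDensity_eq_integral_toReal_smul₀
    hmeas.ennreal_ofReal (by simp)]
  refine setIntegral_congr_fun hW.measurableSet fun x hx => ?_
  rw [hdensity hx, ENNReal.toReal_ofReal (by positivity), smul_eq_mul, mul_comm]

end PullbackDensity

theorem setIntegral_image_mul {a : ℂ} (ha : a ≠ 0) {U : Set ℂ} (hU : MeasurableSet U)
    (h : ℂ → ℝ) : ∫ x in (fun x => a * x) '' U, h x = ‖a‖ ^ 2 * ∫ y in U, h (a * y) := by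
  have hdet : (ContinuousLinearMap.mul ℝ ℂ a).det = ‖a‖ ^ 2 := by
    rw [← Complex.normSq_eq_norm_sq, ← Algebra.norm_complex_apply]
    rfl
  rw [integral_image_eq_integral_abs_det_fderiv_smul volume hU (f := fun x => a * x)
      (fun x _ => (ContinuousLinearMap.mul ℝ ℂ a).hasFDerivAt.hasFDerivWithinAt)
      (mul_right_injective₀ ha).injOn,
    hdet, abs_of_nonneg (by positivity), ← integral_const_mul]
  rfl

section LambdaZero

variable {U : Set ℂ} (hUD : closure U ⊆ puncturedDisc)

include hUD

theorem integrableOn_inv_norm_pow (D : ℕ) :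
    IntegrableOn (fun y : ℂ => (‖y‖ ^ (2 * D + 2))⁻¹ * 2) U := by
  have hK : IsCompact (closure U) := Metric.isCompact_of_isClosed_isBounded isClosed_closure
    (Metric.isBounded_ball.subset fun x hx => mem_ball_zero_iff.2 (hUD hx).2)
  refine (ContinuousOn.integrableOn_compact hK ?_).mono_set subset_closure
  exact ((continuous_norm.pow _).continuousOn.inv₀
    fun y hy => pow_ne_zero _ (norm_ne_zero_iff.2 (hUD hy).1)).mul continuousOn_const

theorem lambdaZero_pos (hU : IsOpen U) (hne : U.Nonempty) {D : ℕ} (hD : D ≠ 0) {w : E}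
    (hw : w ≠ 0) : 0 < lambdaZero U D w := by
  have hpos {y : ℂ} (hy : y ∈ U) : 0 < (‖y‖ ^ (2 * D + 2))⁻¹ * 2 := by
    have := norm_pos_iff.2 (hUD (subset_closure hy)).1
    positivity
  have hint : 0 < ∫ y in U, (‖y‖ ^ (2 * D + 2))⁻¹ * 2 := by
    rw [setIntegral_pos_iff_support_of_nonneg_ae
      ((ae_restrict_mem hU.measurableSet).mono fun y hy => (hpos hy).le)
      (integrableOn_inv_norm_pow hUD D),
      Set.inter_eq_right.2 fun y hy => Function.mem_support.2 (hpos hy).ne']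
    exact hU.measure_pos volume hne
  have := norm_pos_iff.2 hw
  rw [lambdaZero]
  positivity

end LambdaZero

variable [InnerProductSpace ℂ E] [CompleteSpace E] [MeasurableSpace E] [BorelSpace E]
  {f : ℂ → E} {Γ : AddSubgroup E} [BorelSpace (E ⧸ Γ)] {U : Set ℂ} {D : ℕ} {w : E}

theorem integral_mu (hf : DifferentiableOn ℂ f puncturedDisc) (hU : IsOpen U)
    (hUD : U ⊆ puncturedDisc) {a : ℂ} (ha : a ∈ puncturedDisc) (hl : 0 ≤ lambdaZero U D w)
    (g : (E ⧸ Γ) →ᵇ ℝ) :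
    ∫ t, g t ∂mu Γ f D w U a = (lambdaZero U D w)⁻¹ * ∫ y in U, g (proj Γ (f (a * y))) *
      ‖(a * y) ^ (D + 1) • deriv f (a * y)‖ ^ 2 * ((‖y‖ ^ (2 * D + 2))⁻¹ * 2) := by
  have hW : IsOpen ((fun x => a * x) '' U) := (Homeomorph.mulLeft₀ a ha.1).isOpenMap U hU
  have hWD : (fun x => a * x) '' U ⊆ puncturedDisc :=
    Set.image_subset_iff.2 fun y hy => mul_mem_puncturedDisc ha (hUD hy)
  have hproj : Continuous (proj Γ) := QuotientAddGroup.continuous_mk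
  rw [mu, integral_smul_measure, integral_map hproj.aemeasurable
    g.continuous.aestronglyMeasurable, integral_areaMeasure hW (hf.mono hWD)
    (φ := fun z => g (proj Γ z)) (g.continuous.comp hproj).aestronglyMeasurable,
    setIntegral_image_mul ha.1 hU.measurableSet, ENNReal.toReal_ofReal (by positivity),
    smul_eq_mul, mul_assoc, ← integral_const_mul, ← integral_const_mul]
  congr 1
  refine setIntegral_congr_fun hU.measurableSet fun y hy => ?_
  have hy0 := norm_ne_zero_iff.2 (hUD hy).1
  rw [norm_smul, norm_pow, norm_mul]
  field_simp
  ring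

theorem tendsto_integral_mu {ι : Type*} [Fintype ι] {Φ : C(UnitAddTorus ι, E ⧸ Γ)}
    {θ : ℂ → ι → ℝ} (hasymp : IsAsymptoticToTorusCurve (fun x => proj Γ (f x)) Φ θ)
    (hf : DifferentiableOn ℂ f puncturedDisc)
    (hlim : Tendsto (fun x => x ^ D • f x) (𝓝[≠] 0) (𝓝 w)) (hD : D ≠ 0) (hw : w ≠ 0)
    (hU : IsOpen U) (hne : U.Nonempty) (hUD : closure U ⊆ puncturedDisc)
    (μ : Measure (UnitAddTorus ι)) [IsProbabilityMeasure μ] [μ.IsAddLeftInvariant]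
    (g : (E ⧸ Γ) →ᵇ ℝ) :
    Tendsto (fun a => ∫ t, g t ∂mu Γ f D w U a) (𝓝[≠] 0) (𝓝 (∫ t, g (Φ t) ∂μ)) := by
  have hF : ContinuousOn (fun x => proj Γ (f x)) puncturedDisc :=
    QuotientAddGroup.continuous_mk.comp_continuousOn hf.continuousOn
  have hgF := g.continuous.comp_continuousOn hF
  have hρ := integrableOn_inv_norm_pow hUD D
  have hpos := lambdaZero_pos hUD hU hne hD hw
  have hδ : Tendsto (fun x => ‖x ^ (D + 1) • deriv f x‖ ^ 2) (𝓝[≠] 0) (𝓝 (D ^ 2 * ‖w‖ ^ 2)) := by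
    simpa only [norm_neg, norm_smul, Complex.norm_natCast, mul_pow] using
      (tendsto_pow_smul_deriv hf hlim).norm.pow 2
  have hsub : Tendsto (fun x => g (proj Γ (f x)) * ‖x ^ (D + 1) • deriv f x‖ ^ 2 -
      g (proj Γ (f x)) * (D ^ 2 * ‖w‖ ^ 2)) (𝓝[≠] 0) (𝓝 0) := by
    simp only [← mul_sub]
    exact bdd_le_mul_tendsto_zero' ‖g‖ (Eventually.of_forall fun x => g.norm_coe_le_norm _)
      (tendsto_sub_nhds_zero_iff.2 hδ)
  have hconst : Tendsto (fun a => ∫ y in U, g (proj Γ (f (a * y))) * (D ^ 2 * ‖w‖ ^ 2) *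
      ((‖y‖ ^ (2 * D + 2))⁻¹ * 2)) (𝓝[≠] 0) (𝓝 ((∫ t, g (Φ t) ∂μ) * lambdaZero U D w)) := by
    rw [lambdaZero, ← integral_const_mul]
    simpa only [mul_assoc (g _)] using
      hasymp.tendsto_setIntegral hF hU.measurableSet hUD μ (hρ.const_mul (D ^ 2 * ‖w‖ ^ 2)) g
  have hmain := (tendsto_setIntegral_comp_mul_of_tendsto_sub hU.measurableSet
    (subset_closure.trans hUD) hρ
    (hgF.mul (((continuous_pow _).continuousOn.smul
      (hf.deriv isOpen_puncturedDisc).continuousOn).norm.pow 2))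
    (hgF.mul continuousOn_const)
    (fun x => (norm_mul_le _ _).trans (mul_le_mul_of_nonneg_right (g.norm_coe_le_norm _)
      (norm_nonneg _))) hsub hconst).const_mul (lambdaZero U D w)⁻¹
  rw [mul_comm (∫ t, g (Φ t) ∂μ), inv_mul_cancel_left₀ hpos.ne'] at hmain
  refine hmain.congr' ?_
  filter_upwards [puncturedDisc_mem_nhdsNE] with a ha
  exact (integral_mu hf hU (subset_closure.trans hUD) ha hpos.le g).symm

end Area

section Closure

theorem puncturedDisc_subset_closedPuncturedDisc : puncturedDisc ⊆ closedPuncturedDisc :=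
  fun _ hx => ⟨hx.1, hx.2.le⟩

theorem closedPuncturedDisc_subset_closure : closedPuncturedDisc ⊆ closure puncturedDisc := by
  intro x hx
  have hball : x ∈ closure (Metric.ball (0 : ℂ) 1) := by
    rw [closure_ball _ one_ne_zero]
    exact mem_closedBall_zero_iff.2 hx.2
  rw [mem_closure_iff_nhds] at hball ⊢
  intro N hN
  obtain ⟨y, ⟨hyN, hy0⟩, hy⟩ := hball _ (inter_mem hN (isOpen_compl_singleton.mem_nhds hx.1))
  exact ⟨y, hyN, hy0, mem_ball_zero_iff.1 hy⟩

theorem closure_image_puncturedDisc {T : Type*} [TopologicalSpace T] [T2Space T] {F : ℂ → T}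
    (hF : ContinuousOn F closedPuncturedDisc) :
    closure (F '' puncturedDisc) =
      F '' closedPuncturedDisc ∪ {t | MapClusterPt t (𝓝[≠] 0) F} := by
  refine Set.Subset.antisymm (fun t ht => ?_) (Set.union_subset ?_ fun t ht => ?_)
  · have hcluster : MapClusterPt t (𝓟 puncturedDisc) F := by
      rw [MapClusterPt, map_principal]
      exact mem_closure_iff_clusterPt.1 ht
    obtain ⟨V, hV, hVt⟩ := mapClusterPt_iff_ultrafilter.1 hcluster
    have hVD : puncturedDisc ∈ V := hV (mem_principal_self _)
    have hVball : Metric.closedBall 0 1 ∈ V :=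
      mem_of_superset hVD fun x hx => mem_closedBall_zero_iff.2 hx.2.le
    obtain ⟨x, hx, hVx⟩ := (isCompact_closedBall (0 : ℂ) 1).ultrafilter_le_nhds V
      (le_principal_iff.2 hVball)
    rcases eq_or_ne x 0 with rfl | hx0
    · exact Or.inr (mapClusterPt_iff_ultrafilter.2 ⟨V, le_inf hVx
        (le_principal_iff.2 (mem_of_superset hVD fun y hy => hy.1)), hVt⟩)
    · have hxD : x ∈ closedPuncturedDisc := ⟨hx0, mem_closedBall_zero_iff.1 hx⟩
      have hVF : Tendsto F V (𝓝 (F x)) := (hF x hxD).mono_left (le_inf hVx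
        (le_principal_iff.2 (mem_of_superset hVD puncturedDisc_subset_closedPuncturedDisc)))
      exact Or.inl ⟨x, hxD, tendsto_nhds_unique hVF hVt⟩
  · rintro _ ⟨x, hx, rfl⟩
    exact ((hF x hx).mono puncturedDisc_subset_closedPuncturedDisc).mem_closure_image
      (closedPuncturedDisc_subset_closure hx)
  · exact ClusterPt.mem_closure_of_mem ht _
      (mem_map.2 (mem_of_superset puncturedDisc_mem_nhdsNE (Set.subset_preimage_image F _)))

end Closure

theorem IsExpansion.flag_le_realSpan_iff {E : Type*} [NormedAddCommGroup E]
    [InnerProductSpace ℂ E] {Γ : AddSubgroup E} [Countable Γ] [IsClosed (Γ : Set E)] {f : ℂ → E}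
    {k : ℕ} {d : ℕ → ℕ} {v : ℕ → E} (he : IsExpansion f k d v)
    (hf : DifferentiableOn ℂ f puncturedDisc) :
    (flag v k).restrictScalars ℝ ≤ realSpan Γ ↔
      IsTranslatedSubtorus Γ (closure (proj Γ '' (affineV v k : Set E))) := by
  refine ⟨fun h => ?_, flag_le_realSpan_of_isTranslatedSubtorus⟩
  obtain ⟨m, ⟨R⟩⟩ := exists_rationalFrame_flag h
  rw [he.closure_image_affineV hf R]
  exact R.isTranslatedSubtorus _

end OneDimFlow

open OneDimFlow in
theorem theorem2p7_general {E : Type*} [NormedAddCommGroup E] [InnerProductSpace ℂ E]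
    [CompleteSpace E] [SecondCountableTopology E] [MeasurableSpace E] [BorelSpace E]
    (Γ : AddSubgroup E) [DiscreteTopology Γ] (f : ℂ → E)
    (hcont : ContinuousOn f closedPuncturedDisc) (hhol : DifferentiableOn ℂ f puncturedDisc)
    (hgrowth : HasPolynomialGrowth f)
    (hunbounded : ¬ Bornology.IsBounded (f '' closedPuncturedDisc)) :
    (∃ (k : ℕ) (d : ℕ → ℕ) (v : ℕ → E), IsExpansion f k d v) ∧
    ∀ (k : ℕ) (d : ℕ → ℕ) (v : ℕ → E), IsExpansion f k d v →
      ((flag v k).restrictScalars ℝ ≤ realSpan Γ ↔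
        IsTranslatedSubtorus Γ (closure (proj Γ '' (affineV v k : Set E)))) ∧
      ((flag v k).restrictScalars ℝ ≤ realSpan Γ →
        (∃ μV : Measure (E ⧸ Γ),
          IsHaarProbabilityOn μV (closure (proj Γ '' (affineV v k : Set E))) ∧
          (∀ ν : Measure (E ⧸ Γ),
            IsHaarProbabilityOn ν (closure (proj Γ '' (affineV v k : Set E))) → ν = μV) ∧
          ∀ U : Set ℂ, IsOpen U → U.Nonempty → closure U ⊆ puncturedDisc →
            ∀ g : (E ⧸ Γ) →ᵇ ℝ,
              Tendsto (fun a => ∫ t, g t ∂mu Γ f (d 1) (v 1) U a) (𝓝[≠] 0)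
                (𝓝 (∫ t, g t ∂μV))) ∧
        clusterSet Γ f = closure (proj Γ '' (affineV v k : Set E)) ∧
        closure (proj Γ '' (f '' puncturedDisc)) =
          proj Γ '' (f '' closedPuncturedDisc) ∪
            closure (proj Γ '' (affineV v k : Set E))) := by
  have hΓclosed : IsClosed (Γ : Set E) := AddSubgroup.isClosed_of_discrete
  have : Countable Γ := countable_of_Lindelof_of_discrete
  refine ⟨exists_isExpansion hcont hhol hgrowth hunbounded,
    fun k d v he => ⟨he.flag_le_realSpan_iff hhol, fun hflag => ?_⟩⟩
  obtain ⟨m, ⟨R⟩⟩ := exists_rationalFrame_flag hflag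
  have hasymp := he.isAsymptoticToTorusCurve hhol R
  have hone : 1 ∈ Finset.Icc 1 k := Finset.mem_Icc.2 ⟨le_rfl, he.one_le⟩
  have hv : v 1 ≠ 0 := he.linearIndep.ne_zero ⟨le_rfl, he.one_le⟩
  rw [he.closure_image_affineV hhol R]
  refine ⟨⟨volume.map (R.torusMap (v (k + 1))),
    isHaarProbabilityOn_map volume (continuous_torusHom Γ R.vec_mem) _,
    fun ν hν => hν.eq_map volume (continuous_torusHom Γ R.vec_mem) _,
    fun U hU hne hUD g => ?_⟩, he.clusterSet_eq_range hhol R, ?_⟩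
  · rw [integral_map (R.torusMap _).continuous.aemeasurable g.continuous.aestronglyMeasurable]
    exact tendsto_integral_mu hasymp hhol he.tendsto_pow_smul_self (he.degree_pos hone).ne' hv
      hU hne hUD volume g
  · rw [← he.clusterSet_eq_range hhol R, Set.image_image, Set.image_image]
    exact closure_image_puncturedDisc (QuotientAddGroup.continuous_mk.comp_continuousOn hcont)

theorem theorem2p7 {E : Type*} [NormedAddCommGroup E] [InnerProductSpace ℂ E]
    [FiniteDimensional ℂ E] [MeasurableSpace E] [BorelSpace E]
    (Γ : AddSubgroup E) [DiscreteTopology Γ] (f : ℂ → E)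
    (hsmooth : ContDiffOn ℝ ∞ f OneDimFlow.closedPuncturedDisc)
    (hhol : DifferentiableOn ℂ f OneDimFlow.puncturedDisc)
    (hgrowth : OneDimFlow.HasPolynomialGrowth f)
    (hunbounded : ¬ Bornology.IsBounded (f '' OneDimFlow.closedPuncturedDisc)) :
    (∃ (k : ℕ) (d : ℕ → ℕ) (v : ℕ → E), OneDimFlow.IsExpansion f k d v) ∧
    ∀ (k : ℕ) (d : ℕ → ℕ) (v : ℕ → E), OneDimFlow.IsExpansion f k d v →
      ((OneDimFlow.flag v k).restrictScalars ℝ ≤ OneDimFlow.realSpan Γ ↔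
        OneDimFlow.IsTranslatedSubtorus Γ
          (closure (OneDimFlow.proj Γ '' (OneDimFlow.affineV v k : Set E)))) ∧
      ((OneDimFlow.flag v k).restrictScalars ℝ ≤ OneDimFlow.realSpan Γ →
        (∃ μV : Measure (E ⧸ Γ),
          OneDimFlow.IsHaarProbabilityOn μV
            (closure (OneDimFlow.proj Γ '' (OneDimFlow.affineV v k : Set E))) ∧
          (∀ ν : Measure (E ⧸ Γ), OneDimFlow.IsHaarProbabilityOn ν
            (closure (OneDimFlow.proj Γ '' (OneDimFlow.affineV v k : Set E))) → ν = μV) ∧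
          ∀ U : Set ℂ, IsOpen U → IsConnected U → closure U ⊆ OneDimFlow.puncturedDisc →
            ∀ g : (E ⧸ Γ) →ᵇ ℝ,
              Tendsto (fun a : ℂ => ∫ t, g t ∂(OneDimFlow.mu Γ f (d 1) (v 1) U a))
                (𝓝[≠] (0 : ℂ)) (𝓝 (∫ t, g t ∂μV))) ∧
        OneDimFlow.clusterSet Γ f =
          closure (OneDimFlow.proj Γ '' (OneDimFlow.affineV v k : Set E)) ∧
        closure (OneDimFlow.proj Γ '' (f '' OneDimFlow.puncturedDisc)) =
          OneDimFlow.proj Γ '' (f '' OneDimFlow.closedPuncturedDisc) ∪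
            closure (OneDimFlow.proj Γ '' (OneDimFlow.affineV v k : Set E))) := by
  have := FiniteDimensional.complete ℂ E
  have := FiniteDimensional.proper ℂ E
  exact (theorem2p7_general Γ f hsmooth.continuousOn hhol hgrowth hunbounded).imp_right
    fun h k d v he => (h k d v he).imp_right fun h hflag => (h hflag).imp_left
      fun ⟨μV, hμV, huniq, hlim⟩ => ⟨μV, hμV, huniq, fun U hU hUc => hlim U hU hUc.nonempty⟩
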